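/- **Setting.** An $s$-stage Runge–Kutta method $(A,b,c)$ with $A\in\mathbb{R}^{s\times s}$, $b\in\mathbb{R}^s$ and $c=A\mathbb{1}$ computes from $y_0$ with step $h$ the value $y_1=y_0+h\sum_i b_i f(Y_i)$, where $Y_i=y_0+h\sum_j a_{ij}f(Y_j)$. It is *ASI-stable* if $I-zA$ is nonsingular for all $z\in\mathbb{C}$ with $\operatorname{Re}z\le 0$ and $(I-zA)^{-1}$ is uniformly bounded there, and *AS-stable* if $I-zA$ is nonsingular for these $z$ and $z\,b^T(I-zA)^{-1}$ is uniformly bounded there. Put $C=\operatorname{diag}(c)$, and for $\ell\ge1$ (with elementwise powers) $$\hat q_\ell=\frac1{\ell!}-\frac{b^Tc^{\ell-1}}{(\ell-1)!},\qquad \hat s_\ell=\frac{c^\ell}{\ell!}-\frac{Ac^{\ell-1}}{(\ell-1)!}.$$ Every rooted tree is $\tau=[\tau_0^\ell]$ (a root with $\ell\ge0$ leaf children) or $\tau=[\tau_0^\ell\,\tau_1\cdots\tau_k]$ with $k\ge1$ and all subtrees $\tau_i$ different from the one-vertex tree $\tau_0$; $|\tau|$ is its number of vertices. Define $V_\tau\subseteq\mathbb{R}^s$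 by $$V_{[\tau_0^\ell]}=\operatorname{span}\{A^j\hat s_{\ell+1}:0\le j<s\},$$ $$V_{[\tau_0^\ell\tau_1\cdots\tau_k]}=\operatorname{span}\{A^{j+1}C^\ell(\beta_1\times\cdots\times\beta_k):0\le j<s,\ \beta_i\in V_{\tau_i}\},$$ where $\times$ is the elementwise product. The method has *semilinear order* $p_{SL}\ge1$ if for every tree with $|\tau|\le p_{SL}$: when $\tau=[\tau_0^\ell]$, $\hat q_{\ell+1}=0$ and $b^T\beta=0$ for all $\beta\in V_\tau$; when $\tau=[\tau_0^\ell\tau_1\cdots\tau_k]$, $b^TA^jC^\ell(\beta_1\times\cdots\times\beta_k)=0$ for all $0\le j<s$ and all $\beta_i\in V_{\tau_i}$. Consider $y'=f(y)=Jy+g(y)$ on $[t_0,t_f]$ ($t_0<t_f$) in $\mathbb{R}^N$ with any inner product and its norm, and assume, for an integer $r\ge p_{SL}$ and constants $L>0$, $M$: 1. $\mu(J)=\max_{\|x\|=1}\langle x,Jx\rangle\le0$; 2. $\|g(x)-g(z)\|\le L\|x-z\|$ for all $x,z\in\mathbb{R}^N$; 3. $g$ is $C^r$ on $\mathbb{R}^N$,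 the solution $y$ is $C^{r+1}$ on $[t_0,t_f]$, $\|y^{(k)}(t)\|\le M$ for $t\in[t_0,t_f]$, $1\le k\le r+1$, and $\|g^{(k)}(x)\|\le M$ for all $x\in\mathbb{R}^N$, $1\le k\le r$. Let $\mathbf{G}^{(k,\ell)}(t)$ be the $k$-linear map on $\mathbb{R}^s\otimes\mathbb{R}^N$ that acts on each of the $s$ blocks as $\frac{d^\ell}{dt^\ell}g^{(k)}(y(t))$. For a matrix $Z$ with $I-A\otimes Z$ invertible define, for $\tau=[\tau_0^\ell]$, $$\Psi_\tau=(I-A\otimes Z)^{-1}\big(\hat s_{\ell+1}\otimes y^{(\ell+1)}(t)\big),\qquad \psi_\tau=\hat q_{\ell+1}y^{(\ell+1)}(t)+(b^T\otimes Z)\Psi_\tau,$$ and for $\tau=[\tau_0^\ell\tau_1\cdots\tau_k]$ $$\Psi_\tau=(I-A\otimes Z)^{-1}(AC^\ell\otimes I)\,\mathbf{G}^{(k,\ell)}(t)(\Psi_{\tau_1},\dots,\Psi_{\tau_k}),$$ $$\psi_\tau=(b^T\otimes I)(I-A\otimes Z)^{-1}(C^\ell\otimes I)\,\mathbf{G}^{(k,\ell)}(t)(\Psi_{\tau_1},\dots,\Psi_{\tau_k}).$$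 **Theorem.** Let $(A,b,c)$ be AS- and ASI-stable with semilinear order $p_{SL}$. For every initial value problem as above, every $h\ge0$ and $Z=hJ$, the operator $I-A\otimes Z$ is invertible and $$\psi_\tau(Z,t)=0\qquad\text{for all trees with }|\tau|\le p_{SL}\text{ and all }t\in[t_0,t_f].$$ Moreover there are constants $D,\tilde h>0$ depending only on $L$, $M$ and the method (in particular not on $J$, $Z$, $N$ or the inner product) such that, for every such problem, every $t\in[t_0,t_f]$ and every $h\in[0,\tilde h)$, the stage equations of the step of size $h$ starting from the exact value $y(t)$ have a unique solution, and, if $t+h\le t_f$, the result $y_1$ of this step satisfies $$\|y(t+h)-y_1\|\le D\,h^{p_{SL}+1}.$$ -/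

import Mathlib

open scoped Matrix

universe u

/-! ### Runge-Kutta methods -/

/-- An `s`-stage Runge-Kutta method, given by its coefficient matrix `A` and its weights `b`.
The abscissae are determined by the row-sum condition, see `RKMethod.c`. -/
structure RKMethod (s : ℕ) where
  A : Matrix (Fin s) (Fin s) ℝ
  b : Fin s → ℝ

namespace RKMethod

variable {s : ℕ} (R : RKMethod s)

/-- The abscissae `c = A 𝟙`. -/
def c : Fin s → ℝ := R.A *ᵥ 1

/-- The diagonal matrix `C = diag(c)`. -/
def C : Matrix (Fin s) (Fin s) ℝ := Matrix.diagonal R.c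

/-- The complex matrix `I - z A`. -/
noncomputable def resolventMatrix (z : ℂ) : Matrix (Fin s) (Fin s) ℂ :=
  1 - z • R.A.map (fun a : ℝ => (a : ℂ))

/-- ASI-stability: `I - z A` is nonsingular for all `z` with `Re z ≤ 0`, and `(I - z A)⁻¹` is
uniformly bounded there (a bound on all the entries, that is, a bound in any matrix norm). -/
def IsASIStable : Prop :=
  (∀ z : ℂ, z.re ≤ 0 → IsUnit (R.resolventMatrix z)) ∧
  ∃ B : ℝ, ∀ z : ℂ, z.re ≤ 0 → ∀ i j, ‖(R.resolventMatrix z)⁻¹ i j‖ ≤ B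

/-- AS-stability: `I - z A` is nonsingular for all `z` with `Re z ≤ 0`, and the row vector
`z bᵀ (I - z A)⁻¹` is uniformly bounded there. -/
def IsASStable : Prop :=
  (∀ z : ℂ, z.re ≤ 0 → IsUnit (R.resolventMatrix z)) ∧
  ∃ B : ℝ, ∀ z : ℂ, z.re ≤ 0 → ∀ j,
    ‖z * ((fun i => (R.b i : ℂ)) ᵥ* (R.resolventMatrix z)⁻¹) j‖ ≤ B

/-- `q̂_ℓ = 1/ℓ! - bᵀ c^(ℓ-1) / (ℓ-1)!`, for `ℓ ≥ 1`. -/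
noncomputable def qHat (l : ℕ) : ℝ :=
  1 / (l.factorial : ℝ) - (R.b ⬝ᵥ R.c ^ (l - 1)) / ((l - 1).factorial : ℝ)

/-- `ŝ_ℓ = c^ℓ / ℓ! - A c^(ℓ-1) / (ℓ-1)!`, for `ℓ ≥ 1` (powers of `c` are elementwise). -/
noncomputable def sHat (l : ℕ) : Fin s → ℝ :=
  (1 / (l.factorial : ℝ)) • R.c ^ l - (1 / ((l - 1).factorial : ℝ)) • (R.A *ᵥ R.c ^ (l - 1))

/-- The stage equations `Y_i = y₀ + h ∑ⱼ a_ij f(Y_j)` of one step of size `h` from `y₀`. -/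
def IsStageSolution {E : Type u} [AddCommGroup E] [Module ℝ E]
    (f : E → E) (h : ℝ) (y₀ : E) (Y : Fin s → E) : Prop :=
  ∀ i, Y i = y₀ + h • ∑ j, R.A i j • f (Y j)

/-- The result `y₁ = y₀ + h ∑ᵢ b_i f(Y_i)` of one step of size `h` from `y₀` with stages `Y`. -/
def step {E : Type u} [AddCommGroup E] [Module ℝ E]
    (f : E → E) (h : ℝ) (y₀ : E) (Y : Fin s → E) : E :=
  y₀ + h • ∑ i, R.b i • f (Y i)

end RKMethod

/-! ### Rooted trees in standardized form -/

/-- Rooted trees, written as `[τ₀^ℓ]` (a root with `ℓ` leaf children) or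
`[τ₀^ℓ τ₁ … τ_(k+1)]` (a root with `ℓ` leaf children to which `k + 1` further subtrees are
attached). The terms of this type that satisfy `IsStandard` below are exactly the standardized
forms of rooted trees. An unordered tree has one such form for each ordering of its
non-leaf branches; all notions below are symmetric in the branches, so quantifying over these
terms is the same as quantifying over rooted trees. -/
inductive RKTree : Type
  | bushy (l : ℕ) : RKTree
  | graft (l k : ℕ) (τ : Fin (k + 1) → RKTree) : RKTree

namespace RKTree

/-- The one-vertex tree `τ₀`. -/
def single : RKTree := bushy 0

/-- In a standardized form the attached subtrees are different from `τ₀` (leaf children of a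
vertex are all counted by its exponent `ℓ`), at every level. -/
def IsStandard : RKTree → Prop
  | bushy _ => True
  | graft _ _ τ => ∀ i, τ i ≠ single ∧ (τ i).IsStandard

/-- The number of vertices `|τ|`. -/
def size : RKTree → ℕ
  | bushy l => l + 1
  | graft l _ τ => 1 + l + ∑ i, (τ i).size

end RKTree

/-! ### Semilinear order conditions -/

namespace RKMethod

variable {s : ℕ} (R : RKMethod s)

/-- The space `V_τ ⊆ ℝ^s`; the product of the vectors `β i` is elementwise. -/
noncomputable def V : RKTree → Submodule ℝ (Fin s → ℝ)
  | .bushy l => Submodule.span ℝ {v | ∃ j < s, v = R.A ^ j *ᵥ R.sHat (l + 1)}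
  | .graft l _ τ => Submodule.span ℝ
      {v | ∃ j < s, ∃ β : _ → Fin s → ℝ, (∀ i, β i ∈ V (τ i)) ∧
        v = (R.A ^ (j + 1) * R.C ^ l) *ᵥ ∏ i, β i}

/-- The algebraic conditions attached to one tree. -/
def OrderCondition : RKTree → Prop
  | .bushy l => R.qHat (l + 1) = 0 ∧ ∀ β ∈ R.V (.bushy l), R.b ⬝ᵥ β = 0
  | .graft l _ τ => ∀ j < s, ∀ β : _ → Fin s → ℝ, (∀ i, β i ∈ R.V (τ i)) →
      R.b ⬝ᵥ ((R.A ^ j * R.C ^ l) *ᵥ ∏ i, β i) = 0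

/-- The method has semilinear order `p`, where `p ≥ 1`. -/
def HasSemilinearOrder (p : ℕ) : Prop :=
  1 ≤ p ∧ ∀ τ : RKTree, τ.IsStandard → τ.size ≤ p → R.OrderCondition τ

end RKMethod

/-! ### Semilinear initial value problems -/

section Problem

variable {E : Type u} [NormedAddCommGroup E] [InnerProductSpace ℝ E]

/-- The logarithmic norm `μ(J) = max_{‖x‖ = 1} ⟨x, J x⟩` of the inner product norm. -/
noncomputable def logNorm (J : E →L[ℝ] E) : ℝ :=
  ⨆ x : Metric.sphere (0 : E) 1, inner ℝ (x : E) (J x)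

variable (E) in
/-- An initial value problem `y' = J y + g(y)` on `[t₀, t_f]`, together with its exact
solution `y` (only the values of `y` on `[t₀, t_f]` matter; the initial value is `y t₀`). -/
structure SemilinearIVP where
  J : E →L[ℝ] E
  g : E → E
  t₀ : ℝ
  t_f : ℝ
  lt : t₀ < t_f
  y : ℝ → E
  solves : ∀ t ∈ Set.Icc t₀ t_f, HasDerivWithinAt y (J (y t) + g (y t)) (Set.Icc t₀ t_f) t

namespace SemilinearIVP

variable (P : SemilinearIVP E)

/-- The right-hand side `f(y) = J y + g(y)`. -/
def f (x : E) : E := P.J x + P.g x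

/-- The assumptions on the problem, with smoothness parameter `r` and constants `L`, `M`. -/
structure Assumption (r : ℕ) (L M : ℝ) : Prop where
  logNorm_nonpos : logNorm P.J ≤ 0
  L_pos : 0 < L
  lipschitz : ∀ x z, ‖P.g x - P.g z‖ ≤ L * ‖x - z‖
  g_smooth : ContDiff ℝ r P.g
  y_smooth : ContDiffOn ℝ (r + 1) P.y (Set.Icc P.t₀ P.t_f)
  y_bound : ∀ k, 1 ≤ k → k ≤ r + 1 → ∀ t ∈ Set.Icc P.t₀ P.t_f,
    ‖iteratedDerivWithin k P.y (Set.Icc P.t₀ P.t_f) t‖ ≤ M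
  g_bound : ∀ k, 1 ≤ k → k ≤ r → ∀ x, ‖iteratedFDeriv ℝ k P.g x‖ ≤ M

/-- The derivative `y^(k)(t)` of the exact solution, one-sided at the end points. -/
noncomputable def yDeriv (k : ℕ) (t : ℝ) : E :=
  iteratedDerivWithin k P.y (Set.Icc P.t₀ P.t_f) t

/-- The `k`-linear map `d^ℓ/dt^ℓ g^(k)(y(t))`. -/
noncomputable def gDeriv (k l : ℕ) (t : ℝ) : E [×k]→L[ℝ] E :=
  iteratedDerivWithin l (fun t' => iteratedFDeriv ℝ k P.g (P.y t')) (Set.Icc P.t₀ P.t_f) t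

/-- The blockwise extension of `gDeriv` to `ℝ^s ⊗ E`, realized as `Fin s → E`. -/
noncomputable def gDerivBlock {s : ℕ} (k l : ℕ) (t : ℝ) (U : Fin k → Fin s → E) : Fin s → E :=
  fun i => P.gDeriv k l t (fun j => U j i)

end SemilinearIVP

/-- The Kronecker product `B ⊗ Z` acting on `ℝ^s ⊗ E`, realized as `Fin s → E`. -/
noncomputable def kron {s : ℕ} (B : Matrix (Fin s) (Fin s) ℝ) (Z : E →L[ℝ] E) :
    (Fin s → E) →L[ℝ] (Fin s → E) :=
  ContinuousLinearMap.pi fun i => ∑ j, B i j • Z.comp (ContinuousLinearMap.proj j)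

/-- The Kronecker product `βᵀ ⊗ Z`, mapping `ℝ^s ⊗ E` to `E`. -/
noncomputable def kronRow {s : ℕ} (β : Fin s → ℝ) (Z : E →L[ℝ] E) : (Fin s → E) →L[ℝ] E :=
  ∑ j, β j • Z.comp (ContinuousLinearMap.proj j)

/-- The elementary tensor `β ⊗ u`. -/
def tensorVec {s : ℕ} (β : Fin s → ℝ) (u : E) : Fin s → E := fun i => β i • u

namespace RKMethod

variable {s : ℕ} (R : RKMethod s)

/-- `I - A ⊗ Z`. -/
noncomputable def stageOp (Z : E →L[ℝ] E) : (Fin s → E) →L[ℝ] (Fin s → E) := 1 - kron R.A Z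

/-- `(I - A ⊗ Z)⁻¹` (meaningful when `I - A ⊗ Z` is invertible). -/
noncomputable def stageOpInv (Z : E →L[ℝ] E) : (Fin s → E) →L[ℝ] (Fin s → E) :=
  Ring.inverse (R.stageOp Z)

/-- The elementary stage error terms `Ψ_τ(Z, t) ∈ ℝ^s ⊗ E`. -/
noncomputable def stagePsi (P : SemilinearIVP E) (Z : E →L[ℝ] E) (t : ℝ) : RKTree → Fin s → E
  | .bushy l => R.stageOpInv Z (tensorVec (R.sHat (l + 1)) (P.yDeriv (l + 1) t))
  | .graft l k τ => R.stageOpInv Z (kron (R.A * R.C ^ l) (ContinuousLinearMap.id ℝ E)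
      (P.gDerivBlock (k + 1) l t (fun j => stagePsi P Z t (τ j))))

/-- The elementary error terms `ψ_τ(Z, t) ∈ E`. -/
noncomputable def psi (P : SemilinearIVP E) (Z : E →L[ℝ] E) (t : ℝ) : RKTree → E
  | .bushy l => R.qHat (l + 1) • P.yDeriv (l + 1) t +
      kronRow R.b Z (R.stagePsi P Z t (.bushy l))
  | .graft l k τ => kronRow R.b (ContinuousLinearMap.id ℝ E)
      (R.stageOpInv Z (kron (R.C ^ l) (ContinuousLinearMap.id ℝ E)
        (P.gDerivBlock (k + 1) l t (fun j => R.stagePsi P Z t (τ j)))))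

end RKMethod

end Problem

/-! The proof rests on bounds uniform over all dissipative `Z`, on invariant subspaces that carry
the error terms, and on a bootstrap in powers of `h`.

Bounds. Let d(X) = det(I - X A). Stability keeps the complex zeros of d out of the closed left
half-plane, so over ℝ it splits into linear and quadratic factors with zeros of positive real part.
For each such factor dissipativity alone bounds the powers of `Z` up to the degree of the factor,
and products inherit this (`dominatesPowers_of_aeval_ne_zero`). By Cramer's rule (I - zA)⁻¹ is the
adjugate over d. Its boundedness as z → -∞ forces the adjugate entries to have degree at most deg d,
and AS-stability does the same for z bᵀ adj. Hence (I - A⊗Z)⁻¹ and (bᵀ⊗Z)(I - A⊗Z)⁻¹ are bounded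
independently of `Z`, the space and the inner product (`IsASIStable.exists_norm_le`,
`IsASStable.exists_norm_kronRow_le`).

Invariance. By Cayley–Hamilton each V_τ is A-invariant, so V_τ ⊗ E is invariant under I - A⊗Z and,
by finite dimension, under its inverse. Thus Ψ_τ lies in V_τ ⊗ E, and the order conditions
annihilate ψ_τ (`psi_eq_zero`).

Local error. The exact solution is replaced by its Taylor polynomial, which is defined even where t
+ c_i h leaves the interval. The stage error solves a linear equation with operator I - A⊗hJ whose
right side is a quadrature error, h times the error of g, and a term of order p + 1 (`stageOp_err`).
If the stage error is known up to O(h^q) as a sum of terms in the spaces V_τ ⊗ E, Taylor expansion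
of g gives the same kind of expansion for the error of g, and the factor h yields order q + 1
(`hasExpansion_err`). No tree coefficients are tracked: only the subspace containing each term
matters, since bᵀ vanishes on it. -/

/-! ### Polynomials in a dissipative operator. -/

open Polynomial in
-- A quotient of larger numerator degree is unbounded as x → -∞; substituting `-X` moves this limit
-- to +∞.
theorem Polynomial.natDegree_le_of_abs_eval_le {q d : ℝ[X]} {B : ℝ}
    (hd : ∀ x ≤ 0, d.eval x ≠ 0) (h : ∀ x ≤ 0, |q.eval x| ≤ B * |d.eval x|) :
    q.natDegree ≤ d.natDegree := by
  by_contra! hlt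
  have hd0 : d ≠ 0 := by
    rintro rfl
    exact hd 0 le_rfl (by simp)
  have hX : (-X : ℝ[X]).natDegree = 1 := by simp
  have hc0 : d.comp (-X) ≠ 0 := by
    intro h0
    refine hd 0 le_rfl ?_
    have := congrArg (eval 0) h0
    simpa [eval_comp] using this
  have hdeg : (d.comp (-X)).degree < (q.comp (-X)).degree := by
    apply degree_lt_degree
    rwa [natDegree_comp, natDegree_comp, hX, mul_one, mul_one]
  have ht := (q.comp (-X)).abs_div_tendsto_atTop_atTop_of_degree_gt (d.comp (-X)) hdeg hc0
  obtain ⟨x, hx, hx0⟩ := ((ht.eventually_gt_atTop B).and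
    (Filter.eventually_ge_atTop (0 : ℝ))).exists
  have hx' : -x ≤ 0 := by linarith
  have h1 := h (-x) hx'
  have h2 := abs_pos.mpr (hd (-x) hx')
  simp only [eval_comp, eval_neg, eval_X, abs_div] at hx
  rw [lt_div_iff₀ h2] at hx
  linarith

/-- The operator `Z` is dissipative. -/
def IsDissipative {E : Type u} [NormedAddCommGroup E] [InnerProductSpace ℝ E]
    (Z : E →L[ℝ] E) : Prop := ∀ x, inner ℝ x (Z x) ≤ 0

open Polynomial in
/-- `d(Z)` dominates `Z ^ k` for `k ≤ deg d`, uniformly in the dissipative operator `Z`. -/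
def DominatesPowers (d : ℝ[X]) : Prop :=
  ∃ K : ℝ, 0 ≤ K ∧ ∀ (E : Type u) [NormedAddCommGroup E] [InnerProductSpace ℝ E]
    (Z : E →L[ℝ] E), IsDissipative Z → ∀ x, ∀ k ≤ d.natDegree,
      ‖(Z ^ k) x‖ ≤ K * ‖aeval Z d x‖

section Dominates

open Polynomial

/-- Split the exponent as i + j with i ≤ deg d and j ≤ deg e. Polynomials in `Z` commute, so the
bound for d can be used at Z^j x and the one for e at d(Z) x. -/
theorem DominatesPowers.mul {d e : ℝ[X]} (hd0 : d ≠ 0) (he0 : e ≠ 0)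
    (hd : DominatesPowers.{u} d) (he : DominatesPowers.{u} e) : DominatesPowers.{u} (d * e) := by
  obtain ⟨K, hK, h1⟩ := hd
  obtain ⟨K', hK', h2⟩ := he
  refine ⟨K * K', by positivity, fun E _ _ Z hZ x k hk => ?_⟩
  rw [natDegree_mul hd0 he0] at hk
  obtain ⟨i, j, hi, hj, rfl⟩ : ∃ i j, i ≤ d.natDegree ∧ j ≤ e.natDegree ∧ k = i + j :=
    ⟨min k d.natDegree, k - min k d.natDegree, by omega, by omega, by omega⟩
  calc ‖(Z ^ (i + j)) x‖ = ‖(Z ^ i) ((Z ^ j) x)‖ := by rw [pow_add]; rfl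
    _ ≤ K * ‖aeval Z d ((Z ^ j) x)‖ := h1 E Z hZ _ i hi
    _ = K * ‖(Z ^ j) (aeval Z d x)‖ := by
        have : aeval Z d * Z ^ j = Z ^ j * aeval Z d := by
          rw [← aeval_X_pow (R := ℝ) Z, ← map_mul, mul_comm, map_mul]
        exact congrArg (fun T : E →L[ℝ] E => K * ‖T x‖) this
    _ ≤ K * (K' * ‖aeval Z e (aeval Z d x)‖) := by gcongr; exact h2 E Z hZ _ j hj
    _ = K * K' * ‖aeval Z (d * e) x‖ := by rw [mul_comm d e, map_mul, mul_assoc]; rfl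

theorem dominatesPowers_C {r : ℝ} (hr : r ≠ 0) : DominatesPowers.{u} (C r) := by
  refine ⟨|r|⁻¹, by positivity, fun E _ _ Z hZ x k hk => ?_⟩
  obtain rfl : k = 0 := by simpa using hk
  have hr' : |r| ≠ 0 := by simpa using hr
  have : aeval Z (C r) x = r • x := by
    rw [aeval_C, Algebra.algebraMap_eq_smul_one]; rfl
  rw [this, norm_smul, Real.norm_eq_abs, inv_mul_cancel_left₀ hr']
  simp

/-- Pair a x - Z x with x and apply Cauchy–Schwarz. -/
theorem IsDissipative.norm_le_of_pos {E : Type u} [NormedAddCommGroup E] [InnerProductSpace ℝ E]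
    {Z : E →L[ℝ] E} (hZ : IsDissipative Z) {a : ℝ} (x : E) :
    a * ‖x‖ ≤ ‖Z x - a • x‖ := by
  rcases eq_or_ne x 0 with rfl | hx
  · simp
  have hx' : 0 < ‖x‖ := norm_pos_iff.mpr hx
  have h1 : a * ‖x‖ ^ 2 ≤ inner ℝ x (a • x - Z x) := by
    rw [inner_sub_right, real_inner_smul_right, real_inner_self_eq_norm_sq]
    linarith [hZ x]
  have h2 := real_inner_le_norm x (a • x - Z x)
  rw [norm_sub_rev] at h2
  nlinarith

theorem dominatesPowers_X_sub_C {r : ℝ} (hr : 0 < r) : DominatesPowers.{u} (X - C r) := by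
  -- The summand r⁻¹ serves k = 0 and the summand 2 serves k = 1, where ‖Zx‖ ≤ ‖(Z - r)x‖ + r‖x‖.
  refine ⟨r⁻¹ + 2, by positivity, fun E _ _ Z hZ x k hk => ?_⟩
  have hval : aeval Z (X - C r) x = Z x - r • x := by
    rw [map_sub, aeval_X, aeval_C, Algebra.algebraMap_eq_smul_one]; rfl
  have h0 := hZ.norm_le_of_pos (a := r) x
  have h1 : ‖x‖ ≤ r⁻¹ * ‖Z x - r • x‖ := by
    rw [inv_mul_eq_div, le_div_iff₀ hr]; linarith
  rw [natDegree_X_sub_C] at hk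
  rw [hval]
  interval_cases k
  · have : (Z ^ 0) x = x := by simp
    rw [this]
    nlinarith [norm_nonneg (Z x - r • x)]
  · rw [pow_one]
    have h2 : ‖Z x‖ ≤ ‖Z x - r • x‖ + r * ‖x‖ := by
      have := norm_add_le (Z x - r • x) (r • x)
      rwa [sub_add_cancel, norm_smul, Real.norm_eq_abs, abs_of_pos hr] at this
    have : 0 ≤ r⁻¹ * ‖Z x - r • x‖ := by positivity
    nlinarith

/-- The factor is (X - a)² + b², with zeros a ± ib; the argument stays real. With w = (Z - a)x the
value is y = (Z - a)w + b²x. Since ⟨w, x⟩ ≤ 0, pairing -y with w gives a‖w‖ ≤ ‖y‖, and a‖x‖ ≤ ‖w‖ is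
the linear case. The constant is the sum of those for k = 0, 1, 2. -/
theorem dominatesPowers_quadratic {a b : ℝ} (ha : 0 < a) :
    DominatesPowers.{u} (X ^ 2 - C (2 * a) * X + C (a ^ 2 + b ^ 2)) := by
  refine ⟨(a⁻¹) ^ 2 + 2 * a⁻¹ + (1 + 2 * a * (2 * a⁻¹) + (a ^ 2 + b ^ 2) * (a⁻¹) ^ 2),
    by positivity, fun E _ _ Z hZ x k hk => ?_⟩
  set y := aeval Z (X ^ 2 - C (2 * a) * X + C (a ^ 2 + b ^ 2)) x with hy
  have hval : y = Z (Z x) - (2 * a) • Z x + (a ^ 2 + b ^ 2) • x := by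
    rw [hy, map_add, map_sub, map_mul, map_pow, aeval_X, aeval_C, aeval_C,
      Algebra.algebraMap_eq_smul_one, Algebra.algebraMap_eq_smul_one, pow_two]
    simp
  set w := Z x - a • x with hw
  -- `w + i b x` is mapped to `y` by `Z - (a + i b)`
  have h1 : a * ‖w‖ ≤ ‖y‖ := by
    rcases eq_or_ne w 0 with h0 | h0
    · simp [h0]
    have hpos : 0 < ‖w‖ := norm_pos_iff.mpr h0
    have e1 : y = Z w - a • w + (b ^ 2) • x := by
      rw [hval, hw, map_sub, map_smul]; module
    have e2 : inner ℝ w y = inner ℝ w (Z w) - a * ‖w‖ ^ 2 + b ^ 2 * inner ℝ w x := by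
      rw [e1, inner_add_right, inner_sub_right, real_inner_smul_right, real_inner_smul_right,
        real_inner_self_eq_norm_sq]
    have e3 : inner ℝ w x = inner ℝ x (Z x) - a * ‖x‖ ^ 2 := by
      rw [hw, real_inner_comm, inner_sub_right, real_inner_smul_right, real_inner_self_eq_norm_sq]
    have e4 : inner ℝ w x ≤ 0 := by
      rw [e3]; nlinarith [hZ x, sq_nonneg ‖x‖]
    have e5 : a * ‖w‖ ^ 2 ≤ inner ℝ w (-y) := by
      rw [inner_neg_right, e2]
      nlinarith [hZ w, mul_nonneg (sq_nonneg b) (neg_nonneg.mpr e4)]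
    have e6 := real_inner_le_norm w (-y)
    rw [norm_neg] at e6
    nlinarith
  have h2 : a * ‖x‖ ≤ ‖w‖ := hZ.norm_le_of_pos x
  have h1' : ‖w‖ ≤ a⁻¹ * ‖y‖ := by
    rw [inv_mul_eq_div, le_div_iff₀ ha]; linarith
  have h2' : ‖x‖ ≤ a⁻¹ ^ 2 * ‖y‖ := by
    have : ‖x‖ ≤ a⁻¹ * ‖w‖ := by rw [inv_mul_eq_div, le_div_iff₀ ha]; linarith
    calc ‖x‖ ≤ a⁻¹ * ‖w‖ := this
      _ ≤ a⁻¹ * (a⁻¹ * ‖y‖) := by gcongr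
      _ = _ := by ring
  have h3 : ‖Z x‖ ≤ 2 * a⁻¹ * ‖y‖ := by
    have e : Z x = w + a • x := by rw [hw]; abel
    have := norm_add_le w (a • x)
    rw [norm_smul, Real.norm_eq_abs, abs_of_pos ha] at this
    rw [e]; linarith
  have h4 : ‖Z (Z x)‖ ≤ (1 + 2 * a * (2 * a⁻¹) + (a ^ 2 + b ^ 2) * (a⁻¹) ^ 2) * ‖y‖ := by
    have e : Z (Z x) = y + (2 * a) • Z x - (a ^ 2 + b ^ 2) • x := by rw [hval]; abel
    have e1 := norm_sub_le (y + (2 * a) • Z x) ((a ^ 2 + b ^ 2) • x)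
    have e2 := norm_add_le y ((2 * a) • Z x)
    rw [norm_smul, Real.norm_eq_abs, abs_of_nonneg (by positivity)] at e1 e2
    rw [e]
    have e3 : 2 * a * ‖Z x‖ ≤ 2 * a * (2 * a⁻¹ * ‖y‖) := by gcongr
    have e4 : (a ^ 2 + b ^ 2) * ‖x‖ ≤ (a ^ 2 + b ^ 2) * (a⁻¹ ^ 2 * ‖y‖) := by gcongr
    linarith
  have hdeg : (X ^ 2 - C (2 * a) * X + C (a ^ 2 + b ^ 2)).natDegree ≤ 2 := by compute_degree
  have p1 : 0 ≤ a⁻¹ ^ 2 * ‖y‖ := by positivity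
  have p2 : 0 ≤ 2 * a⁻¹ * ‖y‖ := by positivity
  have p3 : 0 ≤ (1 + 2 * a * (2 * a⁻¹) + (a ^ 2 + b ^ 2) * (a⁻¹) ^ 2) * ‖y‖ := by positivity
  rw [add_mul, add_mul]
  have hk2 := hk.trans hdeg
  clear hk
  interval_cases k
  · have : (Z ^ 0) x = x := by simp
    rw [this]; linarith
  · rw [pow_one]; linarith
  · have : (Z ^ 2) x = Z (Z x) := by rw [pow_two]; rfl
    rw [this]; linarith

/-- Induction on the degree: every complex zero has positive real part, and a real zero splits off a
linear factor, a nonreal one a quadratic factor. -/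
theorem dominatesPowers_of_aeval_ne_zero (d : ℝ[X])
    (hd : ∀ z : ℂ, z.re ≤ 0 → aeval z d ≠ 0) : DominatesPowers.{u} d := by
  induction hn : d.natDegree using Nat.strong_induction_on generalizing d with
  | _ n ih =>
  have hd0 : d ≠ 0 := by
    rintro rfl
    exact hd 0 (by simp) (by simp)
  rcases Nat.eq_zero_or_pos n with h0 | hpos
  · rw [h0] at hn
    rw [eq_C_of_natDegree_eq_zero hn] at hd0 ⊢
    exact dominatesPowers_C (by simpa using hd0)
  have key : ∀ q e : ℝ[X], d = q * e → 0 < q.natDegree → DominatesPowers.{u} q →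
      DominatesPowers.{u} d := by
    intro q e hqe hq hdom
    have hq0 : q ≠ 0 := by rintro rfl; simp at hq
    have he0 : e ≠ 0 := by rintro rfl; simp [hqe] at hd0
    have hdeg := natDegree_mul hq0 he0
    rw [hqe]
    refine hdom.mul hq0 he0 (ih e.natDegree ?_ e ?_ rfl)
    · rw [hqe] at hn; omega
    · intro z hz hze
      exact hd z hz (by rw [hqe, map_mul, hze, mul_zero])
  obtain ⟨z, hz⟩ : ∃ z : ℂ, aeval z d = 0 :=
    IsAlgClosed.exists_aeval_eq_zero ℂ d (by
      rw [degree_eq_natDegree hd0, hn]; exact_mod_cast hpos.ne')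
  have hzre : 0 < z.re := by
    by_contra! h
    exact hd z h hz
  by_cases him : z.im = 0
  · have hzr : z = (z.re : ℂ) := Complex.ext rfl (by simpa using him)
    have hroot : d.IsRoot z.re := by
      rw [hzr] at hz
      have h2 : aeval ((algebraMap ℝ ℂ) z.re) d = 0 := hz
      rw [aeval_algebraMap_apply_eq_algebraMap_eval] at h2
      exact FaithfulSMul.algebraMap_injective ℝ ℂ (by rw [h2, map_zero])
    obtain ⟨e, he⟩ := dvd_iff_isRoot.mpr hroot
    exact key _ e he (by simp) (dominatesPowers_X_sub_C hzre)
  · obtain ⟨e, he⟩ := d.quadratic_dvd_of_aeval_eq_zero_im_ne_zero hz him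
    have hnorm : ‖z‖ ^ 2 = z.re ^ 2 + z.im ^ 2 := by
      rw [Complex.sq_norm, Complex.normSq_apply]; ring
    rw [hnorm] at he
    refine key _ e he ?_ (dominatesPowers_quadratic hzre)
    have : (X ^ 2 - C (2 * z.re) * X + C (z.re ^ 2 + z.im ^ 2)).natDegree = 2 := by
      compute_degree!
    omega

/-- Plays the role of von Neumann's inequality for q/d: the constant depends on q and d only, not on
`Z` or the space. -/
theorem DominatesPowers.norm_aeval_le {d : ℝ[X]} (hd : DominatesPowers.{u} d) {q : ℝ[X]}
    (hq : q.natDegree ≤ d.natDegree) :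
    ∃ K : ℝ, 0 ≤ K ∧ ∀ (E : Type u) [NormedAddCommGroup E] [InnerProductSpace ℝ E]
      (Z : E →L[ℝ] E), IsDissipative Z → ∀ x, ‖aeval Z q x‖ ≤ K * ‖aeval Z d x‖ := by
  obtain ⟨K, hK, h⟩ := hd
  refine ⟨(∑ i ∈ Finset.range (q.natDegree + 1), |q.coeff i|) * K, by positivity,
    fun E _ _ Z hZ x => ?_⟩
  rw [aeval_eq_sum_range, sum_apply, Finset.sum_mul, Finset.sum_mul]
  refine (norm_sum_le _ _).trans (Finset.sum_le_sum fun i hi => ?_)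
  rw [smul_apply, norm_smul, Real.norm_eq_abs, mul_assoc]
  gcongr
  exact h E Z hZ x i (by have := Finset.mem_range.mp hi; omega)

theorem DominatesPowers.injective_aeval {d : ℝ[X]} (hd : DominatesPowers.{u} d) {E : Type u}
    [NormedAddCommGroup E] [InnerProductSpace ℝ E] {Z : E →L[ℝ] E} (hZ : IsDissipative Z) :
    Function.Injective (aeval Z d) := by
  obtain ⟨K, hK, h⟩ := hd
  refine (injective_iff_map_eq_zero _).mpr fun x hx => ?_
  have := h E Z hZ x 0 (Nat.zero_le _)
  rw [hx] at this
  simp_all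

end Dominates

theorem IsDissipative.of_logNorm_nonpos {E : Type u} [NormedAddCommGroup E]
    [InnerProductSpace ℝ E] {J : E →L[ℝ] E} (hJ : logNorm J ≤ 0) : IsDissipative J := by
  intro x
  rcases eq_or_ne x 0 with rfl | hx
  · simp
  have hx' : 0 < ‖x‖ := norm_pos_iff.mpr hx
  -- The real supremum in `logNorm` bounds its members only if the set is bounded; `‖J‖` is a bound.
  have hbdd : BddAbove (Set.range fun x : Metric.sphere (0 : E) 1 => inner ℝ (x : E) (J x)) := by
    refine ⟨‖J‖, ?_⟩
    rintro _ ⟨v, rfl⟩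
    have hv : ‖(v : E)‖ = 1 := norm_eq_of_mem_sphere v
    calc inner ℝ (v : E) (J v) ≤ ‖(v : E)‖ * ‖J v‖ := real_inner_le_norm _ _
      _ ≤ ‖(v : E)‖ * (‖J‖ * ‖(v : E)‖) := by gcongr; exact J.le_opNorm _
      _ = ‖J‖ := by simp [hv]
  have h1 := (le_ciSup hbdd ⟨‖x‖⁻¹ • x, by simp [norm_smul, hx'.ne']⟩).trans hJ
  simp only [map_smul, real_inner_smul_left, real_inner_smul_right] at h1
  have h2 : 0 < ‖x‖⁻¹ := inv_pos.mpr hx'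
  by_contra! h3
  have := mul_pos h2 (mul_pos h2 h3)
  linarith

theorem IsDissipative.smul {E : Type u} [NormedAddCommGroup E] [InnerProductSpace ℝ E]
    {J : E →L[ℝ] E} (hJ : IsDissipative J) {h : ℝ} (hh : 0 ≤ h) : IsDissipative (h • J) := by
  intro x
  rw [smul_apply, real_inner_smul_right]
  exact mul_nonpos_of_nonneg_of_nonpos hh (hJ x)

/-! ### Kronecker products on stage vectors, in the maximum norm over the blocks. -/

section Kron

variable {E : Type u} [NormedAddCommGroup E] [InnerProductSpace ℝ E] {s : ℕ}

theorem kron_apply (B : Matrix (Fin s) (Fin s) ℝ) (Z : E →L[ℝ] E) (U : Fin s → E) (i : Fin s) :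
    kron B Z U i = ∑ j, B i j • Z (U j) := by
  simp [kron, sum_apply]

theorem kronRow_apply (β : Fin s → ℝ) (Z : E →L[ℝ] E) (U : Fin s → E) :
    kronRow β Z U = ∑ j, β j • Z (U j) := by
  simp [kronRow, sum_apply]

theorem RKMethod.stageOp_apply (R : RKMethod s) (Z : E →L[ℝ] E) (U : Fin s → E) (i : Fin s) :
    R.stageOp Z U i = U i - ∑ j, R.A i j • Z (U j) := by
  simp [stageOp, kron_apply]

theorem kron_tensorVec (B : Matrix (Fin s) (Fin s) ℝ) (Z : E →L[ℝ] E) (β : Fin s → ℝ) (u : E) :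
    kron B Z (tensorVec β u) = tensorVec (B *ᵥ β) (Z u) := by
  ext i
  simp [kron_apply, tensorVec, Matrix.mulVec, dotProduct, smul_smul, Finset.sum_smul]

theorem kronRow_tensorVec (b : Fin s → ℝ) (Z : E →L[ℝ] E) (β : Fin s → ℝ) (u : E) :
    kronRow b Z (tensorVec β u) = (b ⬝ᵥ β) • Z u := by
  simp [kronRow_apply, tensorVec, dotProduct, smul_smul, Finset.sum_smul]

theorem norm_kron_le (B : Matrix (Fin s) (Fin s) ℝ) (Z : E →L[ℝ] E) (U : Fin s → E) :
    ‖kron B Z U‖ ≤ (∑ i, ∑ j, |B i j|) * (‖Z‖ * ‖U‖) := by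
  refine (pi_norm_le_iff_of_nonneg (by positivity)).mpr fun i => ?_
  rw [kron_apply]
  calc ‖∑ j, B i j • Z (U j)‖ ≤ ∑ j, |B i j| * (‖Z‖ * ‖U‖) := by
        refine (norm_sum_le _ _).trans (Finset.sum_le_sum fun j _ => ?_)
        rw [norm_smul, Real.norm_eq_abs]
        gcongr
        exact (Z.le_opNorm _).trans (by gcongr; exact norm_le_pi_norm U j)
    _ = (∑ j, |B i j|) * (‖Z‖ * ‖U‖) := by rw [Finset.sum_mul]
    _ ≤ _ := mul_le_mul_of_nonneg_right (Finset.single_le_sum (f := fun i => ∑ j, |B i j|)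
          (fun _ _ => Finset.sum_nonneg fun _ _ => abs_nonneg _) (Finset.mem_univ i))
          (by positivity)

theorem norm_kronRow_le (b : Fin s → ℝ) (Z : E →L[ℝ] E) (U : Fin s → E) :
    ‖kronRow b Z U‖ ≤ (∑ j, |b j|) * (‖Z‖ * ‖U‖) := by
  rw [kronRow_apply, Finset.sum_mul]
  refine (norm_sum_le _ _).trans (Finset.sum_le_sum fun j _ => ?_)
  rw [norm_smul, Real.norm_eq_abs]
  gcongr
  exact (Z.le_opNorm _).trans (by gcongr; exact norm_le_pi_norm U j)

end Kron

/-! ### The stage operator as a polynomial matrix, and its uniform bounds. -/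

section PolynomialMatrix

open Polynomial

variable {E : Type u} [NormedAddCommGroup E] [InnerProductSpace ℝ E] {s : ℕ}

/-- A polynomial matrix `P`, evaluated at an operator `Z`, acting on `Fin s → E`. -/
noncomputable def polyAct (Z : E →L[ℝ] E) (P : Matrix (Fin s) (Fin s) ℝ[X]) (U : Fin s → E) :
    Fin s → E := fun i => ∑ j, aeval Z (P i j) (U j)

theorem polyAct_mul (Z : E →L[ℝ] E) (P Q : Matrix (Fin s) (Fin s) ℝ[X]) (U : Fin s → E) :
    polyAct Z (P * Q) U = polyAct Z P (polyAct Z Q U) := by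
  ext i
  simp only [polyAct, Matrix.mul_apply, map_sum, map_mul, sum_apply]
  rw [Finset.sum_comm]
  rfl

theorem polyAct_smul_one (Z : E →L[ℝ] E) (d : ℝ[X]) (U : Fin s → E) (i : Fin s) :
    polyAct Z (d • (1 : Matrix (Fin s) (Fin s) ℝ[X])) U i = aeval Z d (U i) := by
  rw [polyAct, Finset.sum_eq_single i]
  · simp
  · intro j _ hj
    simp [Matrix.one_apply_ne hj.symm]
  · simp

namespace RKMethod

variable (R : RKMethod s)

/-- The polynomial matrix `I - X A`. -/
noncomputable def pencil : Matrix (Fin s) (Fin s) ℝ[X] := 1 - (X : ℝ[X]) • R.A.map Polynomial.C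

theorem stageOp_eq_polyAct (Z : E →L[ℝ] E) (U : Fin s → E) :
    R.stageOp Z U = polyAct Z R.pencil U := by
  ext i
  have h : ∀ j, aeval Z (R.pencil i j) (U j) =
      (if i = j then U j else 0) - R.A i j • Z (U j) := by
    intro j
    rw [pencil, Matrix.sub_apply, Matrix.smul_apply, Matrix.map_apply, smul_eq_mul, map_sub,
      map_mul, aeval_X, aeval_C, Algebra.algebraMap_eq_smul_one, Matrix.one_apply]
    split_ifs <;> simp
  rw [stageOp_apply, polyAct]
  simp_rw [h]
  simp

theorem map_pencil (z : ℂ) : R.pencil.map (aeval z : ℝ[X] →ₐ[ℝ] ℂ) = R.resolventMatrix z := by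
  ext i j
  simp [pencil, resolventMatrix, Matrix.one_apply, apply_ite (aeval z : ℝ[X] →ₐ[ℝ] ℂ)]
  ring

theorem aeval_det_pencil (z : ℂ) : aeval z R.pencil.det = (R.resolventMatrix z).det := by
  rw [← map_pencil, AlgHom.map_det]; rfl

theorem aeval_adjugate_pencil (z : ℂ) (i j : Fin s) :
    aeval z (R.pencil.adjugate i j) = (R.resolventMatrix z).adjugate i j := by
  have := AlgHom.map_adjugate (aeval z : ℝ[X] →ₐ[ℝ] ℂ) R.pencil
  rw [← map_pencil]
  exact congrFun (congrFun this i) j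

theorem aeval_adjugate_eq {z : ℂ} (hz : IsUnit (R.resolventMatrix z)) (i j : Fin s) :
    aeval z (R.pencil.adjugate i j) =
      aeval z R.pencil.det * (R.resolventMatrix z)⁻¹ i j := by
  have hdet : IsUnit (R.resolventMatrix z).det := (Matrix.isUnit_iff_isUnit_det _).mp hz
  rw [aeval_adjugate_pencil, aeval_det_pencil, Matrix.inv_def, Matrix.smul_apply, smul_eq_mul,
    ← mul_assoc, Ring.mul_inverse_cancel _ hdet, one_mul]

variable {R}

theorem IsASIStable.dominatesPowers (h : R.IsASIStable) : DominatesPowers.{u} R.pencil.det :=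
  dominatesPowers_of_aeval_ne_zero _ fun z hz => by
    rw [aeval_det_pencil]
    exact ((Matrix.isUnit_iff_isUnit_det _).mp (h.1 z hz)).ne_zero

theorem IsASIStable.eval_det_ne_zero (h : R.IsASIStable) {x : ℝ} (hx : x ≤ 0) :
    R.pencil.det.eval x ≠ 0 := by
  intro h0
  have := ((Matrix.isUnit_iff_isUnit_det _).mp (h.1 (algebraMap ℝ ℂ x) (by simpa using hx))).ne_zero
  rw [← aeval_det_pencil, aeval_algebraMap_apply_eq_algebraMap_eval, h0] at this
  simp at this

/-- Only the negative real axis is needed for the degree comparison. -/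
theorem natDegree_le_of_norm_aeval_le (h : R.IsASIStable) {q : ℝ[X]} {B : ℝ}
    (hq : ∀ z : ℂ, z.re ≤ 0 → ‖aeval z q‖ ≤ B * ‖aeval z R.pencil.det‖) :
    q.natDegree ≤ R.pencil.det.natDegree := by
  refine natDegree_le_of_abs_eval_le (B := B) (fun x hx => h.eval_det_ne_zero hx) fun x hx => ?_
  have := hq (algebraMap ℝ ℂ x) (by simpa using hx)
  rw [aeval_algebraMap_apply_eq_algebraMap_eval, aeval_algebraMap_apply_eq_algebraMap_eval] at this
  simpa using this

/-- By Cramer's rule the entries of the bounded resolvent are these adjugate entries divided by the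
determinant. -/
theorem IsASIStable.natDegree_adjugate_le (h : R.IsASIStable) (i j : Fin s) :
    (R.pencil.adjugate i j).natDegree ≤ R.pencil.det.natDegree := by
  obtain ⟨B, hB⟩ := h.2
  refine natDegree_le_of_norm_aeval_le h (B := B) fun z hz => ?_
  rw [aeval_adjugate_eq R (h.1 z hz), norm_mul, mul_comm]
  gcongr
  exact hB z hz i j

theorem IsASStable.natDegree_row_le (hAS : R.IsASStable) (h : R.IsASIStable) (j : Fin s) :
    (X * ∑ i, Polynomial.C (R.b i) * R.pencil.adjugate i j).natDegree ≤ R.pencil.det.natDegree := by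
  obtain ⟨B, hB⟩ := hAS.2
  refine natDegree_le_of_norm_aeval_le h (B := B) fun z hz => ?_
  have e : aeval z (X * ∑ i, Polynomial.C (R.b i) * R.pencil.adjugate i j) =
      aeval z R.pencil.det *
        (z * ((fun i => (R.b i : ℂ)) ᵥ* (R.resolventMatrix z)⁻¹) j) := by
    simp only [map_mul, map_sum, aeval_X, aeval_C, aeval_adjugate_eq R (h.1 z hz),
      Matrix.vecMul, dotProduct, Finset.mul_sum]
    refine Finset.sum_congr rfl fun i _ => ?_
    simp only [Complex.coe_algebraMap]
    ring
  rw [e, norm_mul, mul_comm]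
  gcongr
  exact hB z hz j

theorem IsASIStable.aeval_det_surjective (h : R.IsASIStable) [FiniteDimensional ℝ E]
    {Z : E →L[ℝ] E} (hZ : IsDissipative Z) : Function.Surjective (aeval Z R.pencil.det) :=
  LinearMap.injective_iff_surjective (f := (aeval Z R.pencil.det : E →L[ℝ] E).toLinearMap)
    |>.mp (h.dominatesPowers.injective_aeval hZ)

/-- Multiply by the adjugate, use adj · pencil = det, and cancel det(Z) by injectivity. -/
theorem IsASIStable.eq_polyAct_adjugate (h : R.IsASIStable)
    {Z : E →L[ℝ] E} (hZ : IsDissipative Z) {U w : Fin s → E}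
    (hw : ∀ i, aeval Z R.pencil.det (w i) = R.stageOp Z U i) :
    U = polyAct Z R.pencil.adjugate w := by
  have h1 : polyAct Z (R.pencil.det • 1) w = R.stageOp Z U := by
    ext i; rw [polyAct_smul_one, hw]
  have h2 : polyAct Z (R.pencil.det • 1) U = polyAct Z (R.pencil.det • 1)
      (polyAct Z R.pencil.adjugate w) := by
    have e := congrArg (polyAct Z R.pencil.adjugate) h1
    rw [stageOp_eq_polyAct, ← polyAct_mul, ← polyAct_mul, Matrix.adjugate_mul] at e
    rw [← e, ← polyAct_mul, Matrix.mul_smul, Matrix.smul_mul, mul_one, one_mul]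
  ext i
  apply h.dominatesPowers.injective_aeval hZ
  have := congrFun h2 i
  rwa [polyAct_smul_one, polyAct_smul_one] at this

/-- Solve det(Z) w_i = (I - A⊗Z)U at stage i. Then U is the adjugate applied to w, and each adjugate
entry at w_j is dominated by det(Z) w_j. The constant is fixed before the space and `Z` are. -/
theorem IsASIStable.exists_norm_le (h : R.IsASIStable) :
    ∃ K : ℝ, 0 ≤ K ∧ ∀ (E : Type u) [NormedAddCommGroup E] [InnerProductSpace ℝ E]
      [FiniteDimensional ℝ E] (Z : E →L[ℝ] E), IsDissipative Z → ∀ U : Fin s → E,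
      ‖U‖ ≤ K * ‖R.stageOp Z U‖ := by
  choose K hK hb using fun i j =>
    h.dominatesPowers.{u}.norm_aeval_le (h.natDegree_adjugate_le i j)
  have hK' : ∀ i, 0 ≤ ∑ j, K i j := fun i => Finset.sum_nonneg fun j _ => hK i j
  refine ⟨∑ i, ∑ j, K i j, Finset.sum_nonneg fun i _ => hK' i, fun E _ _ _ Z hZ U => ?_⟩
  choose w hw using fun i => h.aeval_det_surjective hZ (R.stageOp Z U i)
  rw [pi_norm_le_iff_of_nonneg
    (mul_nonneg (Finset.sum_nonneg fun i _ => hK' i) (norm_nonneg _))]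
  intro i
  rw [congrArg (fun V : Fin s → E => ‖V i‖) (h.eq_polyAct_adjugate hZ hw)]
  calc ‖polyAct Z R.pencil.adjugate w i‖ ≤ ∑ j, K i j * ‖R.stageOp Z U‖ := by
        refine (norm_sum_le _ _).trans (Finset.sum_le_sum fun j _ => ?_)
        refine (hb i j E Z hZ _).trans ?_
        rw [hw]
        exact mul_le_mul_of_nonneg_left (norm_le_pi_norm (R.stageOp Z U) j) (hK i j)
    _ = (∑ j, K i j) * ‖R.stageOp Z U‖ := by rw [Finset.sum_mul]
    _ ≤ _ := mul_le_mul_of_nonneg_right (Finset.single_le_sum (f := fun i => ∑ j, K i j)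
          (fun i _ => hK' i) (Finset.mem_univ i)) (norm_nonneg _)

/-- The same argument for the row X bᵀ adj; AS-stability keeps its degree within that of the
determinant in spite of the extra factor X. -/
theorem IsASStable.exists_norm_kronRow_le (hAS : R.IsASStable) (h : R.IsASIStable) :
    ∃ K : ℝ, 0 ≤ K ∧ ∀ (E : Type u) [NormedAddCommGroup E] [InnerProductSpace ℝ E]
      [FiniteDimensional ℝ E] (Z : E →L[ℝ] E), IsDissipative Z → ∀ U : Fin s → E,
      ‖kronRow R.b Z U‖ ≤ K * ‖R.stageOp Z U‖ := by
  choose K hK hb using fun j =>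
    h.dominatesPowers.{u}.norm_aeval_le (hAS.natDegree_row_le h j)
  refine ⟨∑ j, K j, Finset.sum_nonneg fun i _ => hK i, fun E _ _ _ Z hZ U => ?_⟩
  choose w hw using fun i => h.aeval_det_surjective hZ (R.stageOp Z U i)
  have e : kronRow R.b Z U =
      ∑ j, aeval Z (X * ∑ i, Polynomial.C (R.b i) * R.pencil.adjugate i j) (w j) := by
    rw [kronRow_apply]
    conv_lhs => rw [h.eq_polyAct_adjugate hZ hw]
    simp only [polyAct, map_sum, map_mul, aeval_X, aeval_C, Finset.smul_sum,
      Algebra.algebraMap_eq_smul_one, smul_mul_assoc, one_mul, Finset.mul_sum, sum_apply,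
      mul_smul_comm, smul_apply]
    rw [Finset.sum_comm]
    rfl
  rw [e, Finset.sum_mul]
  refine (norm_sum_le _ _).trans (Finset.sum_le_sum fun j _ => ?_)
  refine (hb j E Z hZ _).trans ?_
  rw [hw]
  exact mul_le_mul_of_nonneg_left (norm_le_pi_norm (R.stageOp Z U) j) (hK j)

theorem IsASIStable.stageOp_injective (h : R.IsASIStable) [FiniteDimensional ℝ E]
    {Z : E →L[ℝ] E} (hZ : IsDissipative Z) : Function.Injective (R.stageOp Z) := by
  obtain ⟨K, -, hK⟩ := h.exists_norm_le.{u}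
  refine (injective_iff_map_eq_zero _).mpr fun U hU => ?_
  have := hK E Z hZ U
  rw [hU] at this
  simpa using this

theorem IsASIStable.isUnit_stageOp (h : R.IsASIStable) [FiniteDimensional ℝ E]
    {Z : E →L[ℝ] E} (hZ : IsDissipative Z) : IsUnit (R.stageOp Z) := by
  have hinj : Function.Injective (R.stageOp Z).toLinearMap := h.stageOp_injective hZ
  rw [ContinuousLinearMap.isUnit_iff_bijective]
  exact ⟨hinj, LinearMap.injective_iff_surjective.mp hinj⟩

theorem IsASIStable.stageOp_stageOpInv (h : R.IsASIStable) [FiniteDimensional ℝ E]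
    {Z : E →L[ℝ] E} (hZ : IsDissipative Z) (U : Fin s → E) :
    R.stageOp Z (R.stageOpInv Z U) = U :=
  congrArg (fun T : (Fin s → E) →L[ℝ] (Fin s → E) => T U)
    (Ring.mul_inverse_cancel _ (h.isUnit_stageOp hZ))

end RKMethod

end PolynomialMatrix

/-! ### Cayley–Hamilton and spans. -/

section LinearAlgebra

/-- Cayley–Hamilton, by reducing X^n modulo the characteristic polynomial. It removes the
restriction j < s built into `V` and `OrderCondition`. -/
theorem Matrix.pow_mem_span_pow_lt {s : ℕ} (A : Matrix (Fin s) (Fin s) ℝ) (n : ℕ) :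
    A ^ n ∈ Submodule.span ℝ {B | ∃ j < s, B = A ^ j} := by
  -- For s = 0 the characteristic polynomial is 1 and the degree bound on the remainder fails, but
  -- all matrices coincide.
  rcases Nat.eq_zero_or_pos s with rfl | hs
  · rw [Subsingleton.elim (A ^ n) 0]
    exact Submodule.zero_mem _
  rw [Matrix.pow_eq_aeval_mod_charpoly]
  have hdeg : (Polynomial.X ^ n %ₘ A.charpoly).natDegree < s := by
    have := Polynomial.natDegree_modByMonic_lt (Polynomial.X ^ n) A.charpoly_monic (by
      intro h
      have h2 := A.charpoly_natDegree_eq_dim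
      rw [h] at h2
      simp at h2
      omega)
    simpa using this
  rw [Polynomial.aeval_eq_sum_range' hdeg]
  exact Submodule.sum_mem _ fun i hi => Submodule.smul_mem _ _
    (Submodule.subset_span ⟨i, Finset.mem_range.mp hi, rfl⟩)

theorem Matrix.pow_mulVec_mem {s : ℕ} (A : Matrix (Fin s) (Fin s) ℝ) {v : Fin s → ℝ}
    {W : Submodule ℝ (Fin s → ℝ)} (h : ∀ j < s, A ^ j *ᵥ v ∈ W) (n : ℕ) : A ^ n *ᵥ v ∈ W := by
  have key : ∀ B ∈ Submodule.span ℝ {B | ∃ j < s, B = A ^ j}, B *ᵥ v ∈ W := by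
    intro B hB
    induction hB using Submodule.span_induction with
    | mem B hB => obtain ⟨j, hj, rfl⟩ := hB; exact h j hj
    | zero => rw [Matrix.zero_mulVec]; exact W.zero_mem
    | add B B' _ _ h1 h2 => rw [Matrix.add_mulVec]; exact W.add_mem h1 h2
    | smul a B _ h1 => rw [Matrix.smul_mulVec]; exact W.smul_mem _ h1
  exact key _ (A.pow_mem_span_pow_lt n)

theorem MultilinearMap.mem_of_mem_span {ι : Type*} [Finite ι] {M : ι → Type*} {N : Type*}
    [∀ i, AddCommGroup (M i)] [∀ i, Module ℝ (M i)] [AddCommGroup N] [Module ℝ N]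
    (f : MultilinearMap ℝ M N) {S : ∀ i, Set (M i)} {W : Submodule ℝ N}
    (h : ∀ x, (∀ i, x i ∈ S i) → f x ∈ W) {x : ∀ i, M i}
    (hx : ∀ i, x i ∈ Submodule.span ℝ (S i)) : f x ∈ W := by
  classical
  have := Fintype.ofFinite ι
  choose n c g hg using fun i => Submodule.mem_span_set'.mp (hx i)
  have hx' : x = fun i => ∑ j, c i j • (g i j : M i) := funext fun i => (hg i).symm
  rw [hx', f.map_sum]
  refine W.sum_mem fun r _ => ?_
  rw [f.map_smul_univ]
  exact W.smul_mem _ (h _ fun i => (g i (r i)).2)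

end LinearAlgebra

/-! ### Invariant tensor subspaces and the vanishing of the elementary error terms. -/

section TensorSpan

variable {E : Type u} [NormedAddCommGroup E] [InnerProductSpace ℝ E] {s : ℕ}

variable (E) in
/-- The span of the elementary tensors `β ⊗ u` with `β ∈ S`. -/
def tensorSpan (S : Set (Fin s → ℝ)) : Submodule ℝ (Fin s → E) :=
  Submodule.span ℝ {U | ∃ β ∈ S, ∃ u, U = tensorVec β u}

theorem tensorVec_mem_tensorSpan {S : Set (Fin s → ℝ)} {β : Fin s → ℝ} (hβ : β ∈ S) (u : E) :
    tensorVec β u ∈ tensorSpan E S :=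
  Submodule.subset_span ⟨β, hβ, u, rfl⟩

theorem kron_mem_tensorSpan {S T : Set (Fin s → ℝ)} {B : Matrix (Fin s) (Fin s) ℝ}
    (h : ∀ β ∈ S, B *ᵥ β ∈ T) (Z : E →L[ℝ] E) {U : Fin s → E} (hU : U ∈ tensorSpan E S) :
    kron B Z U ∈ tensorSpan E T := by
  induction hU using Submodule.span_induction with
  | mem U hU =>
    obtain ⟨β, hβ, u, rfl⟩ := hU
    rw [kron_tensorVec]
    exact tensorVec_mem_tensorSpan (h β hβ) _
  | zero => rw [map_zero]; exact Submodule.zero_mem _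
  | add U U' _ _ h1 h2 => rw [map_add]; exact Submodule.add_mem _ h1 h2
  | smul a U _ h1 => rw [map_smul]; exact Submodule.smul_mem _ _ h1

theorem kronRow_eq_zero_of_mem {S : Set (Fin s → ℝ)} {b : Fin s → ℝ}
    (h : ∀ β ∈ S, b ⬝ᵥ β = 0) (Z : E →L[ℝ] E) {U : Fin s → E} (hU : U ∈ tensorSpan E S) :
    kronRow b Z U = 0 := by
  induction hU using Submodule.span_induction with
  | mem U hU =>
    obtain ⟨β, hβ, u, rfl⟩ := hU
    rw [kronRow_tensorVec, h β hβ, zero_smul]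
  | zero => rw [map_zero]
  | add U U' _ _ h1 h2 => rw [map_add, h1, h2, add_zero]
  | smul a U _ h1 => rw [map_smul, h1, smul_zero]

/-- A `k`-linear map acting on each of the `s` blocks. -/
def blockMap {k : ℕ} (s : ℕ) (T : E [×k]→L[ℝ] E) :
    MultilinearMap ℝ (fun _ : Fin k => Fin s → E) (Fin s → E) :=
  MultilinearMap.pi fun i => T.toMultilinearMap.compLinearMap fun _ => LinearMap.proj i

theorem blockMap_apply {k : ℕ} (T : E [×k]→L[ℝ] E) (U : Fin k → Fin s → E) (i : Fin s) :
    blockMap s T U i = T fun j => U j i := rfl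

/-- On elementary tensors a blockwise map takes the elementwise product of the vectors and applies
`T` to the other factors; multilinearity extends this to the spans. -/
theorem blockMap_mem_tensorSpan {k : ℕ} (T : E [×k]→L[ℝ] E) {S : Fin k → Set (Fin s → ℝ)}
    {W : Set (Fin s → ℝ)} (hW : ∀ β : Fin k → Fin s → ℝ, (∀ j, β j ∈ S j) → ∏ j, β j ∈ W)
    {U : Fin k → Fin s → E} (hU : ∀ j, U j ∈ tensorSpan E (S j)) :
    blockMap s T U ∈ tensorSpan E W := by
  refine (blockMap s T).mem_of_mem_span (fun x hx => ?_) hU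
  choose β hβ u hu using hx
  have : blockMap s T x = tensorVec (∏ j, β j) (T u) := by
    ext i
    rw [blockMap_apply]
    have : (fun j => x j i) = fun j => β j i • u j := by
      funext j; rw [hu]; rfl
    rw [this, ContinuousMultilinearMap.map_smul_univ, tensorVec, Finset.prod_apply]
  rw [this]
  exact tensorVec_mem_tensorSpan (hW β hβ) _

theorem SemilinearIVP.gDerivBlock_mem_tensorSpan (P : SemilinearIVP E) (k l : ℕ) (t : ℝ)
    {S : Fin k → Set (Fin s → ℝ)} {U : Fin k → Fin s → E} (hU : ∀ j, U j ∈ tensorSpan E (S j)) :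
    P.gDerivBlock k l t U ∈ tensorSpan E
      {v | ∃ β : Fin k → Fin s → ℝ, (∀ i, β i ∈ S i) ∧ v = ∏ i, β i} := by
  have e : P.gDerivBlock k l t U = blockMap s (P.gDeriv k l t) U := rfl
  rw [e]
  refine blockMap_mem_tensorSpan _ ?_ hU
  intro β hβ
  exact ⟨β, hβ, rfl⟩

namespace RKMethod

variable {R : RKMethod s}

/-- I - A⊗Z maps the subspace injectively into itself, hence onto it by finite dimension, so the
preimage of `U` lies there too. -/
theorem IsASIStable.stageOpInv_mem_tensorSpan (h : R.IsASIStable) [FiniteDimensional ℝ E]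
    {Z : E →L[ℝ] E} (hZ : IsDissipative Z) {S : Set (Fin s → ℝ)} (hS : ∀ β ∈ S, R.A *ᵥ β ∈ S)
    {U : Fin s → E} (hU : U ∈ tensorSpan E S) : R.stageOpInv Z U ∈ tensorSpan E S := by
  have hmaps : ∀ x ∈ tensorSpan E S, (R.stageOp Z).toLinearMap x ∈ tensorSpan E S := fun x hx =>
    Submodule.sub_mem _ hx (kron_mem_tensorSpan hS Z hx)
  have hinj : Function.Injective ((R.stageOp Z).toLinearMap.restrict hmaps) := fun x y hxy =>
    Subtype.ext (h.stageOp_injective hZ (congrArg Subtype.val hxy))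
  obtain ⟨W, hW⟩ := LinearMap.injective_iff_surjective.mp hinj ⟨U, hU⟩
  have hW' : R.stageOp Z W = U := congrArg Subtype.val hW
  have : R.stageOpInv Z U = W := by
    apply h.stageOp_injective hZ
    rw [h.stageOp_stageOpInv hZ, hW']
  rw [this]
  exact W.2

variable (R)

theorem pow_mulVec_sHat_mem_V (l n : ℕ) : R.A ^ n *ᵥ R.sHat (l + 1) ∈ R.V (.bushy l) := by
  refine R.A.pow_mulVec_mem (fun j hj => ?_) n
  rw [V]
  exact Submodule.subset_span ⟨j, hj, rfl⟩

theorem pow_mul_pow_mulVec_prod_mem_V (l k n : ℕ) (τ : Fin (k + 1) → RKTree)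
    {β : Fin (k + 1) → Fin s → ℝ} (hβ : ∀ i, β i ∈ R.V (τ i)) :
    (R.A ^ (n + 1) * R.C ^ l) *ᵥ ∏ i, β i ∈ R.V (.graft l k τ) := by
  have key := R.A.pow_mulVec_mem (v := (R.A * R.C ^ l) *ᵥ ∏ i, β i) (W := R.V (.graft l k τ))
    (fun j hj => by
      rw [V, Matrix.mulVec_mulVec, ← mul_assoc, ← pow_succ]
      exact Submodule.subset_span ⟨j, hj, β, hβ, rfl⟩) n
  rwa [Matrix.mulVec_mulVec, ← mul_assoc, ← pow_succ] at key

theorem mulVec_mem_V (τ : RKTree) {β : Fin s → ℝ} (hβ : β ∈ R.V τ) : R.A *ᵥ β ∈ R.V τ := by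
  cases τ with
  | bushy l =>
    have hβ' := hβ
    rw [V] at hβ'
    induction hβ' using Submodule.span_induction with
    | mem β h =>
      obtain ⟨j, -, rfl⟩ := h
      rw [Matrix.mulVec_mulVec, ← pow_succ']
      exact R.pow_mulVec_sHat_mem_V l (j + 1)
    | zero => rw [Matrix.mulVec_zero]; exact Submodule.zero_mem _
    | add v w hv hw h1 h2 =>
      rw [Matrix.mulVec_add]
      exact Submodule.add_mem _ (h1 (by rwa [V])) (h2 (by rwa [V]))
    | smul a v hv h1 =>
      rw [Matrix.mulVec_smul]
      exact Submodule.smul_mem _ _ (h1 (by rwa [V]))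
  | graft l k τ =>
    have hβ' := hβ
    rw [V] at hβ'
    induction hβ' using Submodule.span_induction with
    | mem β h =>
      obtain ⟨j, -, γ, hγ, rfl⟩ := h
      rw [Matrix.mulVec_mulVec, ← mul_assoc, ← pow_succ']
      exact R.pow_mul_pow_mulVec_prod_mem_V l k (j + 1) τ hγ
    | zero => rw [Matrix.mulVec_zero]; exact Submodule.zero_mem _
    | add v w hv hw h1 h2 =>
      rw [Matrix.mulVec_add]
      exact Submodule.add_mem _ (h1 (by rwa [V])) (h2 (by rwa [V]))
    | smul a v hv h1 =>
      rw [Matrix.mulVec_smul]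
      exact Submodule.smul_mem _ _ (h1 (by rwa [V]))

variable {R} in
theorem OrderCondition.dotProduct_eq_zero {l k : ℕ} {τ : Fin (k + 1) → RKTree}
    (h : R.OrderCondition (.graft l k τ)) (n : ℕ) {β : Fin (k + 1) → Fin s → ℝ}
    (hβ : ∀ i, β i ∈ R.V (τ i)) : R.b ⬝ᵥ ((R.A ^ n * R.C ^ l) *ᵥ ∏ i, β i) = 0 := by
  let W : Submodule ℝ (Fin s → ℝ) :=
    { carrier := {v | R.b ⬝ᵥ v = 0}
      zero_mem' := dotProduct_zero _
      add_mem' := fun {v w} hv hw => by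
        simp only [Set.mem_ofPred_eq] at hv hw ⊢
        rw [dotProduct_add, hv, hw, add_zero]
      smul_mem' := fun a v hv => by
        simp only [Set.mem_ofPred_eq] at hv ⊢
        rw [dotProduct_smul, hv, smul_zero] }
  have key : R.A ^ n *ᵥ (R.C ^ l *ᵥ ∏ i, β i) ∈ W := R.A.pow_mulVec_mem (fun j hj => by
    change R.b ⬝ᵥ _ = 0
    rw [Matrix.mulVec_mulVec]
    exact h j hj β hβ) n
  rw [Matrix.mulVec_mulVec] at key
  exact key

theorem stagePsi_mem_tensorSpan (h : R.IsASIStable) [FiniteDimensional ℝ E]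
    {Z : E →L[ℝ] E} (hZ : IsDissipative Z) (P : SemilinearIVP E) (t : ℝ) (τ : RKTree) :
    R.stagePsi P Z t τ ∈ tensorSpan E (R.V τ : Set (Fin s → ℝ)) := by
  induction τ with
  | bushy l =>
    rw [stagePsi]
    refine h.stageOpInv_mem_tensorSpan hZ (fun β hβ => R.mulVec_mem_V _ hβ)
      (tensorVec_mem_tensorSpan ?_ _)
    simpa using R.pow_mulVec_sHat_mem_V l 0
  | graft l k τ ih =>
    rw [stagePsi]
    refine h.stageOpInv_mem_tensorSpan hZ (fun β hβ => R.mulVec_mem_V _ hβ) ?_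
    refine kron_mem_tensorSpan ?_ _ (P.gDerivBlock_mem_tensorSpan (k + 1) l t
      (S := fun i => (R.V (τ i) : Set (Fin s → ℝ))) ih)
    rintro _ ⟨β, hβ, rfl⟩
    simpa using R.pow_mul_pow_mulVec_prod_mem_V l k 0 τ hβ

/-- For a grafted tree the resolvent acts on C^ℓ(…) without the leading A that occurs in V_τ. The
proof uses the larger A-invariant family A^n C^ℓ(β₁ × ⋯), n ≥ 0, on which bᵀ still vanishes. -/
theorem psi_eq_zero (h : R.IsASIStable) [FiniteDimensional ℝ E]
    {Z : E →L[ℝ] E} (hZ : IsDissipative Z) (P : SemilinearIVP E) (t : ℝ) {τ : RKTree}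
    (hτ : R.OrderCondition τ) : R.psi P Z t τ = 0 := by
  cases τ with
  | bushy l =>
    rw [psi, hτ.1, zero_smul, zero_add]
    exact kronRow_eq_zero_of_mem hτ.2 Z (R.stagePsi_mem_tensorSpan h hZ P t _)
  | graft l k τ =>
    rw [psi]
    refine kronRow_eq_zero_of_mem (S := {v | ∃ (n : ℕ) (β : Fin (k + 1) → Fin s → ℝ),
      (∀ i, β i ∈ R.V (τ i)) ∧ v = (R.A ^ n * R.C ^ l) *ᵥ ∏ i, β i}) ?_ _
      (h.stageOpInv_mem_tensorSpan hZ ?_ ?_)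
    · rintro _ ⟨n, β, hβ, rfl⟩
      exact hτ.dotProduct_eq_zero n hβ
    · rintro _ ⟨n, β, hβ, rfl⟩
      exact ⟨n + 1, β, hβ, by rw [Matrix.mulVec_mulVec, ← mul_assoc, ← pow_succ']⟩
    · refine kron_mem_tensorSpan ?_ _ (P.gDerivBlock_mem_tensorSpan (k + 1) l t
        (S := fun i => (R.V (τ i) : Set (Fin s → ℝ)))
        fun j => R.stagePsi_mem_tensorSpan h hZ P t (τ j))
      rintro _ ⟨β, hβ, rfl⟩
      exact ⟨0, β, hβ, by rw [pow_zero, one_mul]⟩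

end RKMethod

end TensorSpan

/-! ### Taylor polynomials and remainders. -/

section Taylor

variable {E : Type*} [NormedAddCommGroup E] [NormedSpace ℝ E]

/-- The polynomial curve `σ ↦ ∑_{k < q} σ^k / k! • v k`. -/
noncomputable def taylorCurve (q : ℕ) (v : ℕ → E) (σ : ℝ) : E :=
  ∑ k ∈ Finset.range q, ((k.factorial : ℝ)⁻¹ * σ ^ k) • v k

theorem taylorCurve_succ (q : ℕ) (v : ℕ → E) (σ : ℝ) :
    taylorCurve (q + 1) v σ = taylorCurve q v σ + ((q.factorial : ℝ)⁻¹ * σ ^ q) • v q :=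
  Finset.sum_range_succ _ _

theorem taylorCurve_succ' (q : ℕ) (v : ℕ → E) (σ : ℝ) :
    taylorCurve (q + 1) v σ = v 0 +
      ∑ k ∈ Finset.range q, (((k + 1).factorial : ℝ)⁻¹ * σ ^ (k + 1)) • v (k + 1) := by
  rw [taylorCurve, Finset.sum_range_succ', add_comm]
  simp

theorem taylorWithinEval_eq_taylorCurve (f : ℝ → E) (n : ℕ) (s : Set ℝ) (x₀ x : ℝ) :
    taylorWithinEval f n s x₀ x =
      taylorCurve (n + 1) (fun k => iteratedDerivWithin k f s x₀) (x - x₀) :=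
  taylor_within_apply f n s x₀ x

theorem hasDerivAt_taylorCurve (q : ℕ) (v : ℕ → E) (σ : ℝ) :
    HasDerivAt (taylorCurve (q + 1) v) (taylorCurve q (fun k => v (k + 1)) σ) σ := by
  induction q with
  | zero =>
    have : taylorCurve 1 v = fun _ => v 0 := by
      funext σ; simp [taylorCurve]
    rw [this]
    simpa [taylorCurve] using hasDerivAt_const σ (v 0)
  | succ q ih =>
    have h1 : taylorCurve (q + 1 + 1) v = fun σ => taylorCurve (q + 1) v σ +
        (((q + 1).factorial : ℝ)⁻¹ * σ ^ (q + 1)) • v (q + 1) := by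
      funext σ; exact taylorCurve_succ _ _ _
    rw [h1, taylorCurve_succ]
    refine ih.add ?_
    have h2 := ((hasDerivAt_pow (q + 1) σ).const_mul ((q + 1).factorial : ℝ)⁻¹).smul_const
      (v (q + 1))
    convert h2 using 2
    rw [Nat.factorial_succ]
    push_cast
    have : (q.factorial : ℝ) ≠ 0 := by positivity
    field_simp

theorem contDiff_taylorCurve {n : WithTop ℕ∞} (q : ℕ) (v : ℕ → E) : ContDiff ℝ n (taylorCurve q v) := by
  unfold taylorCurve
  fun_prop

theorem iteratedDeriv_taylorCurve (j q : ℕ) (v : ℕ → E) :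
    iteratedDeriv j (taylorCurve (q + j) v) = taylorCurve q (fun k => v (k + j)) := by
  induction j generalizing v with
  | zero => simp
  | succ j ih =>
    have : deriv (taylorCurve (q + j + 1) v) = taylorCurve (q + j) (fun k => v (k + 1)) :=
      funext fun σ => (hasDerivAt_taylorCurve _ _ _).deriv
    rw [iteratedDeriv_succ', ← add_assoc, this, ih]
    rfl

theorem norm_taylorCurve_le {q p : ℕ} (hq : q ≤ p) {v : ℕ → E} {M ρ σ : ℝ}
    (hv : ∀ k < q, ‖v k‖ ≤ M) (hM : 0 ≤ M) (hσ : |σ| ≤ ρ) :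
    ‖taylorCurve q v σ‖ ≤ p * (max 1 ρ ^ p * M) := by
  have hB : ∀ k ∈ Finset.range q, ‖((k.factorial : ℝ)⁻¹ * σ ^ k) • v k‖ ≤ max 1 ρ ^ p * M := by
    intro k hk
    have hk' := Finset.mem_range.mp hk
    rw [norm_smul, norm_mul, norm_inv, norm_pow, Real.norm_eq_abs, Real.norm_eq_abs, Nat.abs_cast]
    have h1 : ((k.factorial : ℝ))⁻¹ ≤ 1 :=
      inv_le_one_of_one_le₀ (by exact_mod_cast Nat.one_le_iff_ne_zero.mpr k.factorial_ne_zero)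
    have h2 : |σ| ^ k ≤ max 1 ρ ^ p :=
      (pow_le_pow_left₀ (abs_nonneg σ) (hσ.trans (le_max_right 1 ρ)) k).trans
        (pow_le_pow_right₀ (le_max_left 1 ρ) (by omega))
    have h3 : ((k.factorial : ℝ))⁻¹ * |σ| ^ k ≤ 1 * max 1 ρ ^ p := by gcongr
    rw [one_mul] at h3
    gcongr
    exact hv k hk'
  calc ‖taylorCurve q v σ‖ ≤ ∑ k ∈ Finset.range q, max 1 ρ ^ p * M :=
        (norm_sum_le _ _).trans (Finset.sum_le_sum hB)
    _ = q * (max 1 ρ ^ p * M) := by simp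
    _ ≤ _ := by gcongr

theorem norm_sub_taylorCurve_one_le {ψ : ℝ → E} {p : ℕ} (hp : 1 ≤ p) (hψ : ContDiff ℝ p ψ) {C : ℝ}
    (hC : ∀ τ ∈ Set.Icc (0 : ℝ) 1, ‖iteratedDeriv p ψ τ‖ ≤ C) :
    ‖ψ 1 - taylorCurve p (fun k => iteratedDeriv k ψ 0) 1‖ ≤ C := by
  obtain ⟨n, rfl⟩ : ∃ n, p = n + 1 := ⟨p - 1, by omega⟩
  have hu : UniqueDiffOn ℝ (Set.Icc (0 : ℝ) 1) := uniqueDiffOn_Icc_zero_one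
  have heq : ∀ k ≤ n + 1, ∀ τ ∈ Set.Icc (0 : ℝ) 1,
      iteratedDerivWithin k ψ (Set.Icc 0 1) τ = iteratedDeriv k ψ τ := fun k hk τ hτ =>
    iteratedDerivWithin_eq_iteratedDeriv hu
      (hψ.contDiffAt.of_le (by exact_mod_cast hk)) hτ
  have h := taylor_mean_remainder_bound (f := ψ) (n := n) (C := C) zero_le_one
    (by exact_mod_cast hψ.contDiffOn) (Set.right_mem_Icc.mpr zero_le_one)
    (fun τ hτ => by rw [heq _ le_rfl τ hτ]; exact hC τ hτ)
  have hC0 : 0 ≤ C := (norm_nonneg _).trans (hC 0 (by simp))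
  have e : taylorWithinEval ψ n (Set.Icc 0 1) 0 1 =
      taylorCurve (n + 1) (fun k => iteratedDeriv k ψ 0) 1 := by
    rw [taylorWithinEval_eq_taylorCurve, sub_zero, taylorCurve, taylorCurve]
    refine Finset.sum_congr rfl fun k hk => ?_
    rw [heq k (Finset.mem_range.mp hk).le 0 (by simp)]
  rw [e, sub_zero, one_pow, mul_one] at h
  exact h.trans (div_le_self hC0
    (by exact_mod_cast Nat.one_le_iff_ne_zero.mpr n.factorial_ne_zero))

/-- Rescaling x ↦ ψ(σx) reduces to the point 1 and covers negative σ, needed because abscissae may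
be negative. -/
theorem norm_sub_taylorCurve_le {ψ : ℝ → E} {p : ℕ} (hp : 1 ≤ p) (hψ : ContDiff ℝ p ψ) {C σ : ℝ}
    (hC : ∀ τ, |τ| ≤ |σ| → ‖iteratedDeriv p ψ τ‖ ≤ C) :
    ‖ψ σ - taylorCurve p (fun k => iteratedDeriv k ψ 0) σ‖ ≤ C * |σ| ^ p := by
  have hs : ContDiff ℝ p (fun x => ψ (σ * x)) := hψ.comp (contDiff_const.mul contDiff_id)
  have key := norm_sub_taylorCurve_one_le hp hs (C := C * |σ| ^ p) (fun τ hτ => by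
    rw [iteratedDeriv_comp_const_smul hψ, norm_smul, norm_pow, Real.norm_eq_abs, mul_comm]
    gcongr
    refine hC _ ?_
    rw [abs_mul]
    exact mul_le_of_le_one_right (abs_nonneg σ) (abs_le.mpr ⟨by linarith [hτ.1], hτ.2⟩))
  have e : taylorCurve p (fun k => iteratedDeriv k (fun x => ψ (σ * x)) 0) 1 =
      taylorCurve p (fun k => iteratedDeriv k ψ 0) σ := by
    refine Finset.sum_congr rfl fun k hk => ?_
    beta_reduce
    rw [iteratedDeriv_comp_const_smul
      (hψ.of_le (by exact_mod_cast (Finset.mem_range.mp hk).le))]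
    beta_reduce
    rw [mul_zero, smul_smul, one_pow, mul_one]
  rwa [e, mul_one] at key

/-- One-variable Taylor along the segment from x to x + w. -/
theorem norm_sub_sum_iteratedFDeriv_le {F : Type*} [NormedAddCommGroup F] [NormedSpace ℝ F]
    {g : E → F} {p : ℕ} (hp : 1 ≤ p) (hg : ContDiff ℝ p g)
    {M : ℝ} (hM : ∀ x, ‖iteratedFDeriv ℝ p g x‖ ≤ M) (x w : E) :
    ‖g (x + w) - ∑ m ∈ Finset.range p, (m.factorial : ℝ)⁻¹ •
      iteratedFDeriv ℝ m g x (fun _ => w)‖ ≤ M * ‖w‖ ^ p := by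
  have hder : ∀ m ≤ p, ∀ τ : ℝ, iteratedDeriv m (fun σ : ℝ => g (x + σ • w)) τ =
      iteratedFDeriv ℝ m g (x + τ • w) (fun _ => w) := by
    intro m hm τ
    have hshift : ContDiff ℝ p (fun z => g (x + z)) := hg.comp (contDiff_const.add contDiff_id)
    have h1 := (ContinuousLinearMap.toSpanSingleton ℝ w).iteratedFDeriv_comp_right
      (f := fun z => g (x + z)) hshift τ (i := m) (by exact_mod_cast hm)
    have h2 : (fun z => g (x + z)) ∘ (ContinuousLinearMap.toSpanSingleton ℝ w) =
        fun σ : ℝ => g (x + σ • w) := by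
      funext σ; simp
    rw [h2] at h1
    rw [iteratedDeriv_eq_iteratedFDeriv, h1, iteratedFDeriv_comp_add_left]
    simp
  have hψ : ContDiff ℝ p (fun σ : ℝ => g (x + σ • w)) := by fun_prop
  have key := norm_sub_taylorCurve_one_le hp hψ (C := M * ‖w‖ ^ p) (fun τ _ => by
    rw [hder p le_rfl]
    refine (ContinuousMultilinearMap.le_opNorm _ _).trans ?_
    rw [Finset.prod_const, Finset.card_univ, Fintype.card_fin]
    gcongr
    exact hM _)
  have e : taylorCurve p (fun k => iteratedDeriv k (fun σ : ℝ => g (x + σ • w)) 0) 1 =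
      ∑ m ∈ Finset.range p, (m.factorial : ℝ)⁻¹ • iteratedFDeriv ℝ m g x (fun _ => w) := by
    refine Finset.sum_congr rfl fun m hm => ?_
    beta_reduce
    rw [hder m (Finset.mem_range.mp hm).le, zero_smul, add_zero, one_pow, mul_one]
  rwa [e, one_smul] at key

/-- In the bound on the derivatives of a composition `g ∘ f`, only the derivatives of `g` of
positive order matter. -/
theorem norm_iteratedDerivWithin_comp_le {F : Type*} [NormedAddCommGroup F] [NormedSpace ℝ F]
    {g : E → F} {f : ℝ → E} {s : Set ℝ} {n : ℕ} (hn : 1 ≤ n)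
    (hg : ContDiff ℝ n g) (hf : ContDiffOn ℝ n f s) (hs : UniqueDiffOn ℝ s) {x : ℝ} (hx : x ∈ s)
    {C D : ℝ} (hC0 : 0 ≤ C) (hC : ∀ i, 1 ≤ i → i ≤ n → ‖iteratedFDeriv ℝ i g (f x)‖ ≤ C)
    (hD : ∀ i, 1 ≤ i → i ≤ n → ‖iteratedDerivWithin i f s x‖ ≤ D ^ i) :
    ‖iteratedDerivWithin n (g ∘ f) s x‖ ≤ n.factorial * C * D ^ n := by
  -- No bound on the values of `g` is available; subtracting the constant g(f x) makes the term of
  -- order zero vanish and changes no derivative of order ≥ 1.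
  have hgc : ContDiff ℝ n (fun z => g z - g (f x)) := hg.sub contDiff_const
  have h := norm_iteratedFDerivWithin_comp_le (g := fun z => g z - g (f x)) (f := f) (n := n)
    (N := n) (t := Set.univ) hgc.contDiffOn hf le_rfl uniqueDiffOn_univ hs (Set.mapsTo_univ _ _) hx
    (C := C) (D := D) (fun i hi => by
      rw [iteratedFDerivWithin_univ]
      rcases Nat.eq_zero_or_pos i with rfl | h0
      · simpa using hC0
      · have := iteratedFDeriv_sub_apply (𝕜 := ℝ) (i := i) (f := g) (g := fun _ => g (f x))
          (x := f x) (hg.contDiffAt.of_le (by exact_mod_cast hi)) contDiffAt_const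
        rw [iteratedFDeriv_const_of_ne h0.ne'] at this
        change ‖iteratedFDeriv ℝ i (g - fun _ => g (f x)) (f x)‖ ≤ C
        rw [this]
        simpa using hC i h0 hi)
    (fun i h1 h2 => by
      rw [norm_iteratedFDerivWithin_eq_norm_iteratedDerivWithin]; exact hD i h1 h2)
  rw [norm_iteratedFDerivWithin_eq_norm_iteratedDerivWithin] at h
  have e : iteratedDerivWithin n ((fun z => g z - g (f x)) ∘ f) s x =
      iteratedDerivWithin n (g ∘ f) s x := by
    have h1 : ((fun z => g z - g (f x)) ∘ f) = (g ∘ f) - (fun _ => g (f x)) := rfl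
    have hgf : ContDiffOn ℝ n (g ∘ f) s := hg.comp_contDiffOn hf
    rw [h1, iteratedDerivWithin_sub hx hs (hgf x hx) contDiffWithinAt_const,
      iteratedDerivWithin_const, if_neg (by omega), sub_zero]
  rwa [e] at h

open Filter Asymptotics in
-- Uniqueness of Taylor coefficients: the limit gives a 0 = 0, then divide by u and repeat.
theorem eq_zero_of_sum_pow_smul_isLittleO {α : Type*} {l : Filter α} [l.NeBot] {u : α → ℝ}
    (hu : Tendsto u l (nhds 0)) (hu0 : ∀ᶠ x in l, u x ≠ 0) (n : ℕ) (a : ℕ → E)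
    (h : (fun x => ∑ k ∈ Finset.range (n + 1), u x ^ k • a k) =o[l] fun x => u x ^ n) :
    ∀ k ≤ n, a k = 0 := by
  induction n generalizing a with
  | zero =>
    intro k hk
    obtain rfl : k = 0 := by omega
    simp only [zero_add, Finset.sum_range_one, pow_zero, one_smul] at h
    exact tendsto_nhds_unique tendsto_const_nhds ((isLittleO_one_iff ℝ).mp h)
  | succ n ih =>
    have h0 : a 0 = 0 := by
      have t1 : Tendsto (fun x => ∑ k ∈ Finset.range (n + 1 + 1), u x ^ k • a k) l (nhds 0) := by
        refine h.trans_tendsto ?_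
        simpa using hu.pow (n + 1)
      have t2 : Tendsto (fun x => ∑ k ∈ Finset.range (n + 1 + 1), u x ^ k • a k) l
          (nhds (∑ k ∈ Finset.range (n + 1 + 1), (0 : ℝ) ^ k • a k)) :=
        tendsto_finsetSum _ fun k _ => (hu.pow k).smul_const _
      have := tendsto_nhds_unique t2 t1
      rw [Finset.sum_range_succ'] at this
      simpa using this
    have h1 : (fun x => ∑ k ∈ Finset.range (n + 1), u x ^ k • a (k + 1)) =o[l]
        fun x => u x ^ n := by
      have e : ∀ x, ∑ k ∈ Finset.range (n + 1 + 1), u x ^ k • a k =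
          u x • ∑ k ∈ Finset.range (n + 1), u x ^ k • a (k + 1) := by
        intro x
        rw [Finset.sum_range_succ', h0, smul_zero, add_zero, Finset.smul_sum]
        simp only [smul_smul, pow_succ']
      simp only [e] at h
      have h2 := ((isBigO_refl (fun x => (u x)⁻¹) l).smul_isLittleO h)
      refine (h2.congr' ?_ ?_)
      · filter_upwards [hu0] with x hx
        rw [inv_smul_smul₀ hx]
      · filter_upwards [hu0] with x hx
        rw [smul_eq_mul, pow_succ']
        field_simp
    intro k hk
    cases k with
    | zero => exact h0
    | succ k => exact ih (fun k => a (k + 1)) h1 k (by omega)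

end Taylor

/-! ### Smoothness of the solution and of the nonlinearity along it. -/

namespace SemilinearIVP

section Smoothness

open Set

variable {E : Type u} [NormedAddCommGroup E] [InnerProductSpace ℝ E] {P : SemilinearIVP E}
  {p : ℕ} {L M : ℝ}

theorem Assumption.mono {r : ℕ} (hpr : p ≤ r) (h : P.Assumption r L M) : P.Assumption p L M where
  logNorm_nonpos := h.logNorm_nonpos
  L_pos := h.L_pos
  lipschitz := h.lipschitz
  g_smooth := h.g_smooth.of_le (by exact_mod_cast hpr)
  y_smooth := h.y_smooth.of_le (by exact_mod_cast Nat.succ_le_succ hpr)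
  y_bound := fun k h1 h2 => h.y_bound k h1 (by omega)
  g_bound := fun k h1 h2 => h.g_bound k h1 (by omega)

theorem Assumption.M_nonneg (h : P.Assumption p L M) : 0 ≤ M :=
  (norm_nonneg _).trans (h.y_bound 1 le_rfl (by omega) P.t₀ (left_mem_Icc.mpr P.lt.le))

theorem uniqueDiffOn (P : SemilinearIVP E) : UniqueDiffOn ℝ (Icc P.t₀ P.t_f) :=
  uniqueDiffOn_Icc P.lt

/-- The derivatives of `t ↦ g (y t)`. -/
noncomputable def gyDeriv (P : SemilinearIVP E) (k : ℕ) (t : ℝ) : E :=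
  iteratedDerivWithin k (P.g ∘ P.y) (Icc P.t₀ P.t_f) t

theorem Assumption.contDiffOn_y (h : P.Assumption p L M) :
    ContDiffOn ℝ p P.y (Icc P.t₀ P.t_f) :=
  h.y_smooth.of_le (by exact_mod_cast Nat.le_succ p)

theorem Assumption.contDiffOn_g_comp_y (h : P.Assumption p L M) :
    ContDiffOn ℝ p (P.g ∘ P.y) (Icc P.t₀ P.t_f) :=
  h.g_smooth.comp_contDiffOn h.contDiffOn_y

theorem Assumption.norm_yDeriv_le (h : P.Assumption p L M) {k : ℕ} (h1 : 1 ≤ k) (h2 : k ≤ p + 1)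
    {t : ℝ} (ht : t ∈ Icc P.t₀ P.t_f) : ‖P.yDeriv k t‖ ≤ M :=
  h.y_bound k h1 h2 t ht

theorem yDeriv_zero (P : SemilinearIVP E) (t : ℝ) : P.yDeriv 0 t = P.y t := by
  simp [yDeriv]

/-- Differentiate the equation k times. This is how `J`, which has no norm bound, is controlled: on
derivatives of the solution it is a difference of bounded quantities once 1 ≤ k. -/
theorem Assumption.J_yDeriv (h : P.Assumption p L M) {k : ℕ} (hk : k ≤ p) {t : ℝ}
    (ht : t ∈ Icc P.t₀ P.t_f) : P.J (P.yDeriv k t) = P.yDeriv (k + 1) t - P.gyDeriv k t := by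
  have hJ : iteratedDerivWithin k (P.J ∘ P.y) (Icc P.t₀ P.t_f) t = P.J (P.yDeriv k t) := by
    rw [iteratedDerivWithin, P.J.iteratedFDerivWithin_comp_left (h.contDiffOn_y t ht)
      P.uniqueDiffOn ht (by exact_mod_cast hk)]
    rfl
  have hd : EqOn (derivWithin P.y (Icc P.t₀ P.t_f)) (P.J ∘ P.y + P.g ∘ P.y) (Icc P.t₀ P.t_f) :=
    fun x hx => (P.solves x hx).derivWithin (P.uniqueDiffOn x hx)
  have e : P.yDeriv (k + 1) t = P.J (P.yDeriv k t) + P.gyDeriv k t := by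
    rw [yDeriv, iteratedDerivWithin_succ', iteratedDerivWithin_congr hd ht,
      iteratedDerivWithin_add ht P.uniqueDiffOn, hJ]
    · rfl
    · exact ((P.J.contDiff.comp_contDiffOn h.contDiffOn_y) t ht).of_le (by exact_mod_cast hk)
    · exact (h.contDiffOn_g_comp_y t ht).of_le (by exact_mod_cast hk)
  rw [e, add_sub_cancel_right]

theorem Assumption.norm_gyDeriv_le (h : P.Assumption p L M) (hp : 1 ≤ p) {t : ℝ}
    (ht : t ∈ Icc P.t₀ P.t_f) : ‖P.gyDeriv p t‖ ≤ p.factorial * M * (max 1 M) ^ p := by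
  refine norm_iteratedDerivWithin_comp_le hp h.g_smooth h.contDiffOn_y P.uniqueDiffOn ht
    h.M_nonneg (fun i h1 h2 => h.g_bound i h1 h2 _) fun i h1 h2 => ?_
  exact (h.y_bound i h1 (by omega) t ht).trans ((le_max_right 1 M).trans
    (le_self_pow₀ (le_max_left 1 M) (by omega)))

/-- The Taylor polynomial of degree `p` of the exact solution about `t`. -/
noncomputable def yCurve (P : SemilinearIVP E) (p : ℕ) (t σ : ℝ) : E :=
  taylorCurve (p + 1) (fun k => P.yDeriv k t) σ

open Filter Asymptotics in
-- The solution and its Taylor polynomial differ by o((x - t)^p), and so do their images under the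
-- Lipschitz `g`. Both compositions then have the same Taylor coefficients below order p.
theorem Assumption.iteratedDeriv_g_comp_yCurve (h : P.Assumption p L M) {t : ℝ}
    (ht : t ∈ Icc P.t₀ P.t_f) {k : ℕ} (hk : k < p) :
    iteratedDeriv k (P.g ∘ P.yCurve p t) 0 = P.gyDeriv k t := by
  obtain ⟨n, rfl⟩ : ∃ n, p = n + 1 := ⟨p - 1, by omega⟩
  set I := Icc P.t₀ P.t_f with hI
  have hφ : ContDiff ℝ (n + 1 : ℕ) (P.g ∘ P.yCurve (n + 1) t) :=
    h.g_smooth.comp (contDiff_taylorCurve _ _)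
  let l := nhdsWithin t (I \ {t})
  have hne : l.NeBot := by
    have := (P.uniqueDiffOn t ht).accPt
    rw [accPt_principal_iff_nhdsWithin] at this
    exact this
  have hlI : l ≤ nhdsWithin t I := nhdsWithin_mono _ sdiff_subset
  have hu : Tendsto (fun x => x - t) l (nhds 0) := by
    have : Tendsto (fun x : ℝ => x - t) (nhds t) (nhds (t - t)) :=
      (continuous_id.sub continuous_const).tendsto t
    rw [sub_self] at this
    exact this.mono_left nhdsWithin_le_nhds
  have hu0 : ∀ᶠ x in l, x - t ≠ 0 := by
    filter_upwards [self_mem_nhdsWithin] with x hx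
    exact sub_ne_zero.mpr hx.2
  have hpow : (fun x => (x - t) ^ (n + 1)) =o[l] fun x => (x - t) ^ n := by
    have := (isLittleO_pow_pow (𝕜 := ℝ) (Nat.lt_succ_self n)).comp_tendsto hu
    exact this
  have t1 : (fun x => (P.g ∘ P.y) x - taylorCurve (n + 1) (fun k => P.gyDeriv k t) (x - t)) =o[l]
      fun x => (x - t) ^ n := by
    have := (taylor_isLittleO (n := n) (convex_Icc P.t₀ P.t_f) ht
      (h.contDiffOn_g_comp_y.of_le (by exact_mod_cast Nat.le_succ n))).mono hlI
    simp only [taylorWithinEval_eq_taylorCurve] at this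
    exact this
  have t2 : (fun x => P.y x - P.yCurve (n + 1) t (x - t)) =o[l] fun x => (x - t) ^ (n + 1) := by
    have := (taylor_isLittleO (n := n + 1) (convex_Icc P.t₀ P.t_f) ht h.contDiffOn_y).mono hlI
    simp only [taylorWithinEval_eq_taylorCurve] at this
    exact this
  have t3 : (fun x => (P.g ∘ P.y) x - (P.g ∘ P.yCurve (n + 1) t) (x - t)) =o[l]
      fun x => (x - t) ^ n := by
    refine (IsBigO.of_bound L (Eventually.of_forall fun x => ?_)).trans_isLittleO (t2.trans hpow)
    exact h.lipschitz _ _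
  have t4 : (fun x => (P.g ∘ P.yCurve (n + 1) t) (x - t) - taylorCurve (n + 1)
      (fun k => iteratedDeriv k (P.g ∘ P.yCurve (n + 1) t) 0) (x - t)) =o[l]
      fun x => (x - t) ^ n := by
    have := (taylor_isLittleO_univ (n := n) (x₀ := 0)
      (hφ.of_le (by exact_mod_cast Nat.le_succ n))).comp_tendsto hu
    simpa only [taylorWithinEval_eq_taylorCurve, Function.comp_def, sub_zero,
      iteratedDerivWithin_univ] using this
  have t5 : (fun x => ∑ k ∈ Finset.range (n + 1), (x - t) ^ k •
      ((k.factorial : ℝ)⁻¹ • (iteratedDeriv k (P.g ∘ P.yCurve (n + 1) t) 0 - P.gyDeriv k t)))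
      =o[l] fun x => (x - t) ^ n := by
    refine ((t1.sub t3).sub t4).congr_left fun x => ?_
    have : ∑ k ∈ Finset.range (n + 1), (x - t) ^ k • ((k.factorial : ℝ)⁻¹ •
        (iteratedDeriv k (P.g ∘ P.yCurve (n + 1) t) 0 - P.gyDeriv k t)) =
        taylorCurve (n + 1) (fun k => iteratedDeriv k (P.g ∘ P.yCurve (n + 1) t) 0) (x - t) -
        taylorCurve (n + 1) (fun k => P.gyDeriv k t) (x - t) := by
      rw [taylorCurve, taylorCurve, ← Finset.sum_sub_distrib]
      refine Finset.sum_congr rfl fun k _ => ?_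
      rw [smul_smul, smul_sub, mul_comm]
    rw [this]
    abel
  have key := eq_zero_of_sum_pow_smul_isLittleO hu hu0 n _ t5 k (by omega)
  have hfac : ((k.factorial : ℝ)⁻¹) ≠ 0 := by positivity
  exact sub_eq_zero.mp ((smul_eq_zero.mp key).resolve_left hfac)

theorem exists_norm_g_yCurve_sub_le (p : ℕ) (hp : 1 ≤ p) (L M ρ : ℝ) :
    ∃ C : ℝ, 0 ≤ C ∧ ∀ (E : Type u) [NormedAddCommGroup E] [InnerProductSpace ℝ E]
      (P : SemilinearIVP E), P.Assumption p L M → ∀ t ∈ Icc P.t₀ P.t_f, ∀ σ : ℝ, |σ| ≤ ρ →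
      ‖P.g (P.yCurve p t σ) - taylorCurve p (fun k => P.gyDeriv k t) σ‖ ≤ C * |σ| ^ p := by
  -- `D` bounds the derivatives of `yCurve` of positive order on |σ| ≤ ρ; these do not involve y(t)
  -- itself. The maximum with 1 gives D ≤ D^i.
  set D := max 1 (p * (max 1 ρ ^ p * M)) with hD
  have hD1 : 1 ≤ D := le_max_left _ _
  refine ⟨|p.factorial * M * D ^ p|, abs_nonneg _, fun E _ _ P h t ht σ hσ => ?_⟩
  have hφ : ContDiff ℝ p (P.g ∘ P.yCurve p t) := h.g_smooth.comp (contDiff_taylorCurve _ _)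
  have key := norm_sub_taylorCurve_le hp hφ (C := |p.factorial * M * D ^ p|) (σ := σ)
    (fun τ hτ => by
      refine le_trans ?_ (le_abs_self _)
      rw [← iteratedDerivWithin_univ]
      refine norm_iteratedDerivWithin_comp_le hp h.g_smooth (contDiff_taylorCurve _ _).contDiffOn
        uniqueDiffOn_univ (mem_univ τ) h.M_nonneg (fun i h1 h2 => h.g_bound i h1 h2 _)
        fun i h1 h2 => ?_
      rw [iteratedDerivWithin_univ]
      have e : p + 1 = (p + 1 - i) + i := by omega
      have e2 : iteratedDeriv i (P.yCurve p t) τ =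
          taylorCurve (p + 1 - i) (fun k => P.yDeriv (k + i) t) τ := by
        unfold yCurve
        conv_lhs => rw [e]
        rw [iteratedDeriv_taylorCurve]
      have h3 := norm_taylorCurve_le (q := p + 1 - i) (p := p) (by omega)
        (v := fun k => P.yDeriv (k + i) t)
        (fun k hk => h.norm_yDeriv_le (k := k + i) (by omega) (by omega) ht) h.M_nonneg
        (hτ.trans hσ)
      have h4 : ‖iteratedDeriv i (P.yCurve p t) τ‖ ≤ D := by
        rw [e2]; exact h3.trans (le_max_right _ _)
      exact h4.trans (le_self_pow₀ hD1 (by omega)))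
  have e : taylorCurve p (fun k => iteratedDeriv k (P.g ∘ P.yCurve p t) 0) σ =
      taylorCurve p (fun k => P.gyDeriv k t) σ := by
    refine Finset.sum_congr rfl fun k hk => ?_
    beta_reduce
    rw [h.iteratedDeriv_g_comp_yCurve ht (Finset.mem_range.mp hk)]
  rwa [e] at key

theorem Assumption.norm_y_sub_yCurve_le (h : P.Assumption p L M) {t η : ℝ}
    (ht : t ∈ Icc P.t₀ P.t_f) (hη : 0 ≤ η) (htη : t + η ≤ P.t_f) :
    ‖P.y (t + η) - P.yCurve p t η‖ ≤ M * η ^ (p + 1) := by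
  -- η = 0 is treated apart because t may equal t_f, where the interval [t, t_f] degenerates.
  rcases hη.eq_or_lt with rfl | hpos
  · rw [yCurve, taylorCurve_succ']
    simp [yDeriv_zero]
  have hlt : t < P.t_f := by linarith
  have hsub : Icc t P.t_f ⊆ Icc P.t₀ P.t_f := Icc_subset_Icc_left ht.1
  have hu : UniqueDiffOn ℝ (Icc t P.t_f) := uniqueDiffOn_Icc hlt
  have heq : ∀ k ≤ p + 1, ∀ x ∈ Icc t P.t_f,
      iteratedDerivWithin k P.y (Icc t P.t_f) x = P.yDeriv k x := by
    intro k hk x hx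
    rw [yDeriv, iteratedDerivWithin, iteratedDerivWithin, iteratedFDerivWithin_subset hsub hu
      P.uniqueDiffOn (h.y_smooth.of_le (by exact_mod_cast hk)) hx]
  have key := taylor_mean_remainder_bound (n := p) (C := M) (x := t + η) hlt.le
    (h.y_smooth.mono hsub) ⟨by linarith, htη⟩ (fun x hx => by
      rw [heq _ le_rfl x hx]
      exact h.norm_yDeriv_le (by omega) le_rfl (hsub hx))
  have e : taylorWithinEval P.y p (Icc t P.t_f) t (t + η) = P.yCurve p t η := by
    rw [taylorWithinEval_eq_taylorCurve, add_sub_cancel_left]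
    refine Finset.sum_congr rfl fun k hk => ?_
    beta_reduce
    rw [heq k (by have := Finset.mem_range.mp hk; omega) t (left_mem_Icc.mpr hlt.le)]
  rw [e, add_sub_cancel_left] at key
  refine key.trans (div_le_self (mul_nonneg h.M_nonneg (by positivity)) ?_)
  exact_mod_cast Nat.one_le_iff_ne_zero.mpr p.factorial_ne_zero

end Smoothness

end SemilinearIVP

/-! ### Orders in `h` and expansions, uniform over all problems and steps. -/

/-- One step of a Runge-Kutta method from an exact value of the solution of a semilinear problem,
together with its stages. -/
structure StepData {s : ℕ} (R : RKMethod s) (p : ℕ) (L M h₀ : ℝ) where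
  E : Type u
  [normed : NormedAddCommGroup E]
  [inner : InnerProductSpace ℝ E]
  [finite : FiniteDimensional ℝ E]
  P : SemilinearIVP E
  assumption : P.Assumption p L M
  t : ℝ
  mem : t ∈ Set.Icc P.t₀ P.t_f
  h : ℝ
  h_nonneg : 0 ≤ h
  h_le : h ≤ h₀
  h_le_one : h ≤ 1
  Y : Fin s → E
  stage : R.IsStageSolution P.f h (P.y t) Y

attribute [instance] StepData.normed StepData.inner StepData.finite

namespace StepData

variable {s : ℕ} {R : RKMethod s} {p : ℕ} {L M h₀ : ℝ}

section IsO

variable {F : StepData.{u} R p L M h₀ → Type u} [∀ κ, NormedAddCommGroup (F κ)]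

/-- `X κ = O(h ^ n)`, uniformly over all problems and steps. -/
def IsO (n : ℕ) (X : ∀ κ : StepData.{u} R p L M h₀, F κ) : Prop :=
  ∃ C : ℝ, 0 ≤ C ∧ ∀ κ, ‖X κ‖ ≤ C * κ.h ^ n

theorem IsO.zero (n : ℕ) : IsO n (fun κ => (0 : F κ)) :=
  ⟨0, le_rfl, fun κ => by simp⟩

theorem IsO.add {n : ℕ} {X Y : ∀ κ, F κ} (hX : IsO n X) (hY : IsO n Y) :
    IsO n (fun κ => X κ + Y κ) := by
  obtain ⟨C, hC, h1⟩ := hX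
  obtain ⟨D, hD, h2⟩ := hY
  refine ⟨C + D, by positivity, fun κ => (norm_add_le _ _).trans ?_⟩
  rw [add_mul]
  exact add_le_add (h1 κ) (h2 κ)

theorem IsO.neg {n : ℕ} {X : ∀ κ, F κ} (hX : IsO n X) : IsO n (fun κ => -X κ) := by
  obtain ⟨C, hC, h1⟩ := hX
  exact ⟨C, hC, fun κ => by rw [norm_neg]; exact h1 κ⟩

theorem IsO.sub {n : ℕ} {X Y : ∀ κ, F κ} (hX : IsO n X) (hY : IsO n Y) :
    IsO n (fun κ => X κ - Y κ) := by
  simpa only [sub_eq_add_neg] using hX.add hY.neg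

theorem IsO.sum {n : ℕ} {ι : Type*} (A : Finset ι) {X : ι → ∀ κ, F κ}
    (h : ∀ a ∈ A, IsO n (X a)) : IsO n (fun κ => ∑ a ∈ A, X a κ) := by
  classical
  induction A using Finset.induction_on with
  | empty => simpa using IsO.zero n
  | insert a A ha ih =>
    simp only [Finset.sum_insert ha]
    exact (h a (by simp)).add (ih fun b hb => h b (by simp [hb]))

theorem IsO.mono {m n : ℕ} (hmn : m ≤ n) {X : ∀ κ, F κ} (hX : IsO n X) : IsO m X := by
  obtain ⟨C, hC, h1⟩ := hX
  refine ⟨C, hC, fun κ => (h1 κ).trans ?_⟩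
  exact mul_le_mul_of_nonneg_left (pow_le_pow_of_le_one κ.h_nonneg κ.h_le_one hmn) hC

theorem IsO.of_norm_le {n : ℕ} {G : StepData.{u} R p L M h₀ → Type u}
    [∀ κ, NormedAddCommGroup (G κ)] {X : ∀ κ, F κ} {Y : ∀ κ, G κ} (hX : IsO n X) {K : ℝ}
    (hK : 0 ≤ K) (h : ∀ κ, ‖Y κ‖ ≤ K * ‖X κ‖) : IsO n Y := by
  obtain ⟨C, hC, h1⟩ := hX
  refine ⟨K * C, by positivity, fun κ => (h κ).trans ?_⟩
  rw [mul_assoc]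
  exact mul_le_mul_of_nonneg_left (h1 κ) hK

theorem IsO.pow_smul [∀ κ, NormedSpace ℝ (F κ)] {n : ℕ} (m : ℕ) {X : ∀ κ, F κ} (hX : IsO n X) :
    IsO (n + m) (fun κ => κ.h ^ m • X κ) := by
  obtain ⟨C, hC, h1⟩ := hX
  refine ⟨C, hC, fun κ => ?_⟩
  have := pow_nonneg κ.h_nonneg m
  rw [norm_smul, Real.norm_eq_abs, abs_of_nonneg this]
  calc κ.h ^ m * ‖X κ‖ ≤ κ.h ^ m * (C * κ.h ^ n) := by gcongr; exact h1 κ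
    _ = C * κ.h ^ (n + m) := by ring

end IsO

/-- `X` has an expansion `∑_{n < q} X_n + O(h ^ q)` whose term `X_n` is `O(h ^ n)` and lies in
`span (S n) ⊗ E`. -/
def HasExpansion (S : ℕ → Set (Fin s → ℝ)) (q : ℕ)
    (X : ∀ κ : StepData.{u} R p L M h₀, Fin s → κ.E) : Prop :=
  ∃ Xn : ℕ → ∀ κ : StepData.{u} R p L M h₀, Fin s → κ.E,
    (∀ n, IsO n (Xn n)) ∧ (∀ n κ, Xn n κ ∈ tensorSpan κ.E (S n)) ∧
    IsO q (fun κ => X κ - ∑ n ∈ Finset.range q, Xn n κ)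

section Expansion

variable {S T : ℕ → Set (Fin s → ℝ)} {q : ℕ} {X Y : ∀ κ : StepData.{u} R p L M h₀, Fin s → κ.E}

theorem HasExpansion.of_isO (hX : IsO q X) : HasExpansion S q X :=
  ⟨fun _ _ => 0, fun n => IsO.zero n, fun _ _ => Submodule.zero_mem _, by simpa using hX⟩

theorem HasExpansion.add (hX : HasExpansion S q X) (hY : HasExpansion S q Y) :
    HasExpansion S q (fun κ => X κ + Y κ) := by
  obtain ⟨Xn, h1, h2, h3⟩ := hX
  obtain ⟨Yn, k1, k2, k3⟩ := hY
  refine ⟨fun n κ => Xn n κ + Yn n κ, fun n => (h1 n).add (k1 n),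
    fun n κ => Submodule.add_mem _ (h2 n κ) (k2 n κ), ?_⟩
  have := h3.add k3
  simp only [Finset.sum_add_distrib]
  convert this using 2
  abel

theorem HasExpansion.of_mem {n : ℕ} (hX : IsO n X) (hS : ∀ κ, X κ ∈ tensorSpan κ.E (S n)) :
    HasExpansion S q X := by
  rcases lt_or_ge n q with hn | hn
  · refine ⟨fun m κ => if m = n then X κ else 0, fun m => ?_, fun m κ => ?_, ?_⟩
    · by_cases hm : m = n
      · subst hm; simpa using hX
      · simpa [hm] using IsO.zero m
    · by_cases hm : m = n
      · subst hm; simpa using hS κ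
      · simp [hm]
    · have : ∀ κ : StepData.{u} R p L M h₀,
          X κ - ∑ m ∈ Finset.range q, (if m = n then X κ else 0) = 0 := by
        intro κ
        rw [Finset.sum_ite_eq', if_pos (Finset.mem_range.mpr hn), sub_self]
      simp only [this]
      exact IsO.zero q
  · exact .of_isO (hX.mono hn)

theorem HasExpansion.sum {ι : Type*} (A : Finset ι)
    {X : ι → ∀ κ : StepData.{u} R p L M h₀, Fin s → κ.E}
    (h : ∀ a ∈ A, HasExpansion S q (X a)) : HasExpansion S q (fun κ => ∑ a ∈ A, X a κ) := by
  classical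
  induction A using Finset.induction_on with
  | empty => exact .of_isO (by simpa using IsO.zero q)
  | insert a A ha ih =>
    simp only [Finset.sum_insert ha]
    exact (h a (by simp)).add (ih fun b hb => h b (by simp [hb]))

theorem HasExpansion.map (hX : HasExpansion S q X)
    (Φ : ∀ κ : StepData.{u} R p L M h₀, (Fin s → κ.E) →L[ℝ] (Fin s → κ.E)) {K : ℝ} (hK : 0 ≤ K)
    (hΦ : ∀ κ U, ‖Φ κ U‖ ≤ K * ‖U‖)
    (hS : ∀ (n : ℕ) (κ : StepData.{u} R p L M h₀), ∀ U ∈ tensorSpan κ.E (S n),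
      Φ κ U ∈ tensorSpan κ.E (T n)) :
    HasExpansion T q (fun κ => Φ κ (X κ)) := by
  obtain ⟨Xn, h1, h2, h3⟩ := hX
  refine ⟨fun n κ => Φ κ (Xn n κ), fun n => (h1 n).of_norm_le hK fun κ => hΦ κ _,
    fun n κ => hS n κ _ (h2 n κ), ?_⟩
  simp only [← map_sum, ← map_sub]
  exact h3.of_norm_le hK fun κ => hΦ κ _

/-- The factor h shifts every term by one index. This is the gain that drives the bootstrap. -/
theorem HasExpansion.smul_map (hX : HasExpansion S q X)
    (Φ : ∀ κ : StepData.{u} R p L M h₀, (Fin s → κ.E) →L[ℝ] (Fin s → κ.E)) {K : ℝ} (hK : 0 ≤ K)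
    (hΦ : ∀ κ U, ‖Φ κ U‖ ≤ K * ‖U‖)
    (hS : ∀ (n : ℕ) (κ : StepData.{u} R p L M h₀), ∀ U ∈ tensorSpan κ.E (S n),
      Φ κ U ∈ tensorSpan κ.E (T (n + 1))) :
    HasExpansion T (q + 1) (fun κ => κ.h • Φ κ (X κ)) := by
  obtain ⟨Xn, h1, h2, h3⟩ := hX
  have hshift : ∀ {n : ℕ} {Z : ∀ κ : StepData.{u} R p L M h₀, Fin s → κ.E}, IsO n Z →
      IsO (n + 1) (fun κ => κ.h • Φ κ (Z κ)) := fun hZ => by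
    simpa only [pow_one] using (hZ.of_norm_le (Y := fun κ => Φ κ (_)) hK fun κ => hΦ κ _).pow_smul 1
  refine ⟨fun n κ => match n with
    | 0 => 0
    | n + 1 => κ.h • Φ κ (Xn n κ), fun n => ?_, fun n κ => ?_, ?_⟩
  · cases n with
    | zero => exact IsO.zero 0
    | succ n => exact hshift (h1 n)
  · cases n with
    | zero => exact Submodule.zero_mem _
    | succ n => exact Submodule.smul_mem _ _ (hS n κ _ (h2 n κ))
  · simp only [Finset.sum_range_succ', add_zero, ← Finset.smul_sum, ← map_sum, ← smul_sub,
      ← map_sub]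
    exact hshift h3

end Expansion

end StepData

/-! ### Tree vectors sorted by the number of vertices. -/

namespace RKMethod

variable {s : ℕ} (R : RKMethod s)

/-- The union of the spaces `V_τ` over all trees `τ ≠ τ₀` with `n` vertices. -/
def treeSet (n : ℕ) : Set (Fin s → ℝ) :=
  {β | ∃ τ : RKTree, τ.IsStandard ∧ τ ≠ .single ∧ τ.size = n ∧ β ∈ R.V τ}

/-- The vectors `A ^ j C ^ l (β₁ × ⋯ × β_k)` for the trees `[τ₀^l τ₁ ⋯ τ_k]` with `n + 1`
vertices. -/
def graftSet (n : ℕ) : Set (Fin s → ℝ) :=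
  {v | ∃ (l k : ℕ) (τ : Fin (k + 1) → RKTree) (j : ℕ) (β : Fin (k + 1) → Fin s → ℝ),
    (RKTree.graft l k τ).IsStandard ∧ (RKTree.graft l k τ).size = n + 1 ∧
    (∀ i, β i ∈ R.V (τ i)) ∧ v = (R.A ^ j * R.C ^ l) *ᵥ ∏ i, β i}

theorem mulVec_mem_treeSet {n : ℕ} {β : Fin s → ℝ} (hβ : β ∈ R.treeSet n) :
    R.A *ᵥ β ∈ R.treeSet n := by
  obtain ⟨τ, h1, h2, h3, h4⟩ := hβ
  exact ⟨τ, h1, h2, h3, R.mulVec_mem_V τ h4⟩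

theorem mulVec_mem_graftSet {n : ℕ} {v : Fin s → ℝ} (hv : v ∈ R.graftSet n) :
    R.A *ᵥ v ∈ R.graftSet n := by
  obtain ⟨l, k, τ, j, β, h1, h2, h3, rfl⟩ := hv
  exact ⟨l, k, τ, j + 1, β, h1, h2, h3, by rw [Matrix.mulVec_mulVec, ← mul_assoc, ← pow_succ']⟩

theorem mulVec_mem_treeSet_of_graftSet {n : ℕ} {v : Fin s → ℝ} (hv : v ∈ R.graftSet n) :
    R.A *ᵥ v ∈ R.treeSet (n + 1) := by
  obtain ⟨l, k, τ, j, β, h1, h2, h3, rfl⟩ := hv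
  refine ⟨.graft l k τ, h1, by simp [RKTree.single], h2, ?_⟩
  rw [Matrix.mulVec_mulVec, ← mul_assoc, ← pow_succ']
  exact R.pow_mul_pow_mulVec_prod_mem_V l k j τ h3

variable {R} in
theorem HasSemilinearOrder.dotProduct_eq_zero {p n : ℕ} (hp : R.HasSemilinearOrder p) (hn : n < p)
    {v : Fin s → ℝ} (hv : v ∈ R.graftSet n) : R.b ⬝ᵥ v = 0 := by
  obtain ⟨l, k, τ, j, β, h1, h2, h3, rfl⟩ := hv
  exact (hp.2 _ h1 (by omega)).dotProduct_eq_zero j h3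

theorem C_pow_mulVec (l : ℕ) (v : Fin s → ℝ) : R.C ^ l *ᵥ v = R.c ^ l * v := by
  ext i
  rw [C, Matrix.diagonal_pow, Matrix.mulVec_diagonal]
  rfl

/-- The factors in `A` are powers of c and merge into C^ℓ with ℓ = Σ_{i ∈ A} r i leaves; the others
become the non-leaf branches, at least one since `A` is not everything. The root accounts for the
extra vertex in `graftSet`. -/
theorem prod_mem_graftSet {m : ℕ} {A : Finset (Fin m)} (hA : A ≠ Finset.univ) (r : Fin m → ℕ)
    {β : Fin m → Fin s → ℝ} (h1 : ∀ i ∈ A, β i = R.c ^ r i)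
    (h2 : ∀ i ∉ A, β i ∈ R.treeSet (r i)) : ∏ i, β i ∈ R.graftSet (∑ i, r i) := by
  classical
  have hcard : 0 < Aᶜ.card := Finset.card_pos.mpr (by
    rw [Finset.nonempty_iff_ne_empty, Ne, Finset.compl_eq_empty_iff]; exact hA)
  obtain ⟨k, hk⟩ : ∃ k, Aᶜ.card = k + 1 := ⟨Aᶜ.card - 1, by omega⟩
  let e := (Finset.equivFinOfCardEq hk).symm
  have he : ∀ j, (e j : Fin m) ∉ A := fun j => Finset.mem_compl.mp (e j).2
  choose τ t1 t2 t3 t4 using h2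
  have hsum : ∀ {N : Type} [AddCommMonoid N] (f : Fin m → N),
      ∑ j, f (e j) = ∑ i ∈ Aᶜ, f i := fun f => by
    rw [e.sum_comp (fun i : ↥Aᶜ => f i), Finset.sum_coe_sort]
  have hprod : ∏ j, β (e j) = ∏ i ∈ Aᶜ, β i := by
    rw [e.prod_comp (fun i : ↥Aᶜ => β i), Finset.prod_coe_sort]
  refine ⟨∑ i ∈ A, r i, k, fun j => τ (e j) (he j), 0, fun j => β (e j), ?_, ?_,
    fun j => t4 _ (he j), ?_⟩
  · rw [RKTree.IsStandard]
    exact fun j => ⟨t2 _ (he j), t1 _ (he j)⟩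
  · rw [RKTree.size]
    simp only [t3, hsum]
    rw [add_assoc, Finset.sum_add_sum_compl, add_comm]
  · rw [pow_zero, one_mul, C_pow_mulVec, hprod, ← Finset.prod_pow_eq_pow_sum,
      ← Finset.prod_congr rfl h1, Finset.prod_mul_prod_compl]

end RKMethod

/-! ### The equation for the stage errors and their a priori bound. -/

namespace StepData

variable {s : ℕ} {R : RKMethod s} {p : ℕ} {L M h₀ : ℝ} (κ : StepData.{u} R p L M h₀)

/-- The Taylor polynomial of the solution at the stages. -/
noncomputable def Yhat (i : Fin s) : κ.E := κ.P.yCurve p κ.t (R.c i * κ.h)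

/-- The error of the stages. -/
noncomputable def err (i : Fin s) : κ.E := κ.Y i - κ.Yhat i

/-- The error of the nonlinearity at the stages. -/
noncomputable def gErr (i : Fin s) : κ.E :=
  κ.P.g (κ.Y i) - taylorCurve p (fun k => κ.P.gyDeriv k κ.t) (R.c i * κ.h)

/-- The quadrature error of the stages. -/
noncomputable def quadErr (i : Fin s) : κ.E :=
  ∑ k ∈ Finset.range p, κ.h ^ (k + 1) •
    tensorVec (R.sHat (k + 1)) (κ.P.yDeriv (k + 1) κ.t) i

/-- The term of order `h ^ (p + 1)` in the equation for the stage errors. -/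
noncomputable def lastErr (i : Fin s) : κ.E :=
  κ.h ^ (p + 1) • tensorVec ((p.factorial : ℝ)⁻¹ • (R.A *ᵥ R.c ^ p))
    (κ.P.J (κ.P.yDeriv p κ.t)) i

/-- The Taylor polynomial of the derivative of the solution at the stages. -/
noncomputable def yDerivHat (i : Fin s) : κ.E :=
  taylorCurve p (fun k => κ.P.yDeriv (k + 1) κ.t) (R.c i * κ.h)

theorem dissipative : IsDissipative (κ.h • κ.P.J) :=
  (IsDissipative.of_logNorm_nonpos κ.assumption.logNorm_nonpos).smul κ.h_nonneg

theorem abs_c_mul_h_le (i : Fin s) : |R.c i * κ.h| ≤ ∑ i, |R.c i| := by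
  rw [abs_mul, abs_of_nonneg κ.h_nonneg]
  calc |R.c i| * κ.h ≤ |R.c i| := mul_le_of_le_one_right (abs_nonneg _) κ.h_le_one
    _ ≤ _ := Finset.single_le_sum (f := fun i => |R.c i|) (fun _ _ => abs_nonneg _)
      (Finset.mem_univ i)

theorem abs_c_mul_h_pow_le (n : ℕ) (i : Fin s) :
    |R.c i * κ.h| ^ n ≤ (∑ i, |R.c i|) ^ n * κ.h ^ n := by
  rw [← mul_pow, abs_mul, abs_of_nonneg κ.h_nonneg]
  have := κ.h_nonneg
  gcongr
  exact Finset.single_le_sum (f := fun i => |R.c i|) (fun _ _ => abs_nonneg _) (Finset.mem_univ i)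

/-- The top coefficient J y^(p) is left as it stands; it produces `lastErr`. -/
theorem J_Yhat (j : Fin s) : κ.P.J (κ.Yhat j) = κ.yDerivHat j -
    taylorCurve p (fun k => κ.P.gyDeriv k κ.t) (R.c j * κ.h) +
    ((p.factorial : ℝ)⁻¹ * (R.c j * κ.h) ^ p) • κ.P.J (κ.P.yDeriv p κ.t) := by
  rw [Yhat, SemilinearIVP.yCurve, taylorCurve_succ, map_add, map_smul, yDerivHat, taylorCurve,
    taylorCurve, taylorCurve, map_sum, ← Finset.sum_sub_distrib]
  congr 1
  refine Finset.sum_congr rfl fun k hk => ?_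
  rw [map_smul, κ.assumption.J_yDeriv (Finset.mem_range.mp hk).le κ.mem, smul_sub]

theorem f_Y (j : Fin s) : κ.P.f (κ.Y j) = κ.gErr j + κ.yDerivHat j +
    ((p.factorial : ℝ)⁻¹ * (R.c j * κ.h) ^ p) • κ.P.J (κ.P.yDeriv p κ.t) +
    κ.P.J (κ.err j) := by
  have := κ.J_Yhat j
  rw [SemilinearIVP.f, err, map_sub, this, gErr]
  abel

theorem smul_sum_yDerivHat (a : Fin s → ℝ) : κ.h • ∑ j, a j • κ.yDerivHat j =
    ∑ k ∈ Finset.range p, (κ.h ^ (k + 1) * ((k.factorial : ℝ)⁻¹ * (a ⬝ᵥ R.c ^ k))) •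
      κ.P.yDeriv (k + 1) κ.t := by
  simp only [yDerivHat, taylorCurve, Finset.smul_sum, smul_smul]
  rw [Finset.sum_comm]
  refine Finset.sum_congr rfl fun k _ => ?_
  rw [← Finset.sum_smul, dotProduct, Finset.mul_sum, Finset.mul_sum]
  congr 1
  refine Finset.sum_congr rfl fun j _ => ?_
  simp only [Pi.pow_apply]
  ring

theorem smul_sum_last (a : Fin s → ℝ) (x : κ.E) :
    κ.h • ∑ j, a j • (((p.factorial : ℝ)⁻¹ * (R.c j * κ.h) ^ p) • x) =
    (κ.h ^ (p + 1) * ((p.factorial : ℝ)⁻¹ * (a ⬝ᵥ R.c ^ p))) • x := by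
  simp only [Finset.smul_sum, smul_smul]
  rw [← Finset.sum_smul, dotProduct, Finset.mul_sum, Finset.mul_sum]
  congr 1
  refine Finset.sum_congr rfl fun j _ => ?_
  simp only [Pi.pow_apply]
  ring

theorem smul_sum_f_Y (a : Fin s → ℝ) : κ.h • ∑ j, a j • κ.P.f (κ.Y j) =
    κ.h • ∑ j, a j • κ.gErr j + ∑ k ∈ Finset.range p,
      (κ.h ^ (k + 1) * ((k.factorial : ℝ)⁻¹ * (a ⬝ᵥ R.c ^ k))) • κ.P.yDeriv (k + 1) κ.t +
    (κ.h ^ (p + 1) * ((p.factorial : ℝ)⁻¹ * (a ⬝ᵥ R.c ^ p))) • κ.P.J (κ.P.yDeriv p κ.t) +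
    κ.h • ∑ j, a j • κ.P.J (κ.err j) := by
  simp only [f_Y, smul_add, Finset.sum_add_distrib]
  rw [smul_sum_yDerivHat, smul_sum_last]

theorem yCurve_eq (σ : ℝ) : κ.P.yCurve p κ.t σ = κ.P.y κ.t + ∑ k ∈ Finset.range p,
    (((k + 1).factorial : ℝ)⁻¹ * σ ^ (k + 1)) • κ.P.yDeriv (k + 1) κ.t := by
  rw [SemilinearIVP.yCurve, taylorCurve_succ', SemilinearIVP.yDeriv_zero]

/-- The Taylor polynomials of g∘y in `gErr` and in `J_Yhat` cancel inside f(Y); comparing the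
remaining derivatives of y with the Taylor polynomial of the stages leaves the residuals `sHat`. -/
theorem stageOp_err : R.stageOp (κ.h • κ.P.J) κ.err = -κ.quadErr +
    κ.h • kron R.A (ContinuousLinearMap.id ℝ κ.E) κ.gErr + κ.lastErr := by
  ext i
  rw [RKMethod.stageOp_apply]
  simp only [Pi.add_apply, Pi.neg_apply, Pi.smul_apply, kron_apply, ContinuousLinearMap.id_apply,
    smul_apply, smul_comm _ κ.h, ← Finset.smul_sum]
  have h1 := κ.stage i
  rw [smul_sum_f_Y κ (R.A i)] at h1
  have h2 : κ.quadErr i = ∑ k ∈ Finset.range p,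
      (((k + 1).factorial : ℝ)⁻¹ * (R.c i * κ.h) ^ (k + 1)) • κ.P.yDeriv (k + 1) κ.t -
      ∑ k ∈ Finset.range p, (κ.h ^ (k + 1) * ((k.factorial : ℝ)⁻¹ * (R.A i ⬝ᵥ R.c ^ k))) •
        κ.P.yDeriv (k + 1) κ.t := by
    rw [quadErr, ← Finset.sum_sub_distrib]
    refine Finset.sum_congr rfl fun k _ => ?_
    rw [tensorVec, smul_smul, ← sub_smul]
    congr 1
    simp only [RKMethod.sHat, Pi.sub_apply, Pi.smul_apply, Pi.pow_apply, smul_eq_mul,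
      Nat.add_sub_cancel, Matrix.mulVec]
    ring
  have h3 : κ.lastErr i = (κ.h ^ (p + 1) * ((p.factorial : ℝ)⁻¹ * (R.A i ⬝ᵥ R.c ^ p))) •
      κ.P.J (κ.P.yDeriv p κ.t) := by
    rw [lastErr, tensorVec, smul_smul]
    rfl
  have h4 := κ.yCurve_eq (R.c i * κ.h)
  have h5 : κ.err i = κ.Y i - κ.P.yCurve p κ.t (R.c i * κ.h) := rfl
  rw [h2, h3, h5, h4, h1]
  abel

theorem isO_yDeriv {k : ℕ} (h1 : 1 ≤ k) (h2 : k ≤ p + 1) :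
    IsO 0 (fun κ : StepData.{u} R p L M h₀ => κ.P.yDeriv k κ.t) :=
  ⟨|M|, abs_nonneg _, fun κ => by
    rw [pow_zero, mul_one]
    exact (κ.assumption.norm_yDeriv_le h1 h2 κ.mem).trans (le_abs_self M)⟩

theorem IsO.tensorVec {n : ℕ} {v : ∀ κ : StepData.{u} R p L M h₀, κ.E} (hv : IsO n v)
    (β : Fin s → ℝ) :
    IsO n (fun κ : StepData.{u} R p L M h₀ => (tensorVec β (v κ) : Fin s → κ.E)) := by
  refine hv.of_norm_le (norm_nonneg β) fun κ => ?_
  refine (pi_norm_le_iff_of_nonneg (by positivity)).mpr fun i => ?_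
  rw [_root_.tensorVec, norm_smul]
  gcongr
  exact norm_le_pi_norm β i

theorem IsO.of_forall_stage {n : ℕ} {X : ∀ κ : StepData.{u} R p L M h₀, Fin s → κ.E}
    {C : ℝ} (hC : 0 ≤ C) (h : ∀ κ i, ‖X κ i‖ ≤ C * κ.h ^ n) : IsO n X :=
  ⟨C, hC, fun κ => (pi_norm_le_iff_of_nonneg
    (mul_nonneg hC (pow_nonneg κ.h_nonneg n))).mpr (h κ)⟩

theorem isO_J_yDeriv (hp : 1 ≤ p) :
    IsO 0 (fun κ : StepData.{u} R p L M h₀ => κ.P.J (κ.P.yDeriv p κ.t)) := by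
  have h1 : IsO 0 (fun κ : StepData.{u} R p L M h₀ => κ.P.gyDeriv p κ.t) :=
    ⟨|p.factorial * M * (max 1 M) ^ p|, abs_nonneg _, fun κ => by
      rw [pow_zero, mul_one]
      exact (κ.assumption.norm_gyDeriv_le hp κ.mem).trans (le_abs_self _)⟩
  have := (isO_yDeriv (R := R) (L := L) (M := M) (h₀ := h₀) (k := p + 1) (by omega) le_rfl).sub h1
  refine this.of_norm_le zero_le_one fun κ => ?_
  rw [one_mul, κ.assumption.J_yDeriv le_rfl κ.mem]

theorem isO_lastErr (hp : 1 ≤ p) :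
    IsO (p + 1) (fun κ : StepData.{u} R p L M h₀ => κ.lastErr) := by
  have := ((isO_J_yDeriv (R := R) (L := L) (M := M) (h₀ := h₀) hp).tensorVec
    ((p.factorial : ℝ)⁻¹ • (R.A *ᵥ R.c ^ p))).pow_smul (p + 1)
  rw [zero_add] at this
  exact this

theorem quadErr_eq : κ.quadErr = ∑ k ∈ Finset.range p, κ.h ^ (k + 1) •
    tensorVec (R.sHat (k + 1)) (κ.P.yDeriv (k + 1) κ.t) := by
  ext i
  simp [quadErr, Finset.sum_apply]

theorem isO_quadErr_term {k : ℕ} (hk : k < p) :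
    IsO (k + 1) (fun κ : StepData.{u} R p L M h₀ => (κ.h ^ (k + 1) •
      tensorVec (R.sHat (k + 1)) (κ.P.yDeriv (k + 1) κ.t) : Fin s → κ.E)) := by
  simpa using ((isO_yDeriv (R := R) (L := L) (M := M) (h₀ := h₀) (k := k + 1) (by omega)
    (by omega)).tensorVec (R.sHat (k + 1))).pow_smul (k + 1)

theorem isO_quadErr : IsO 1 (fun κ : StepData.{u} R p L M h₀ => κ.quadErr) := by
  simp only [quadErr_eq]
  exact IsO.sum _ fun k hk => (isO_quadErr_term (Finset.mem_range.mp hk)).mono (by omega)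

theorem sHat_one : R.sHat 1 = 0 := by
  ext i
  simp [RKMethod.sHat, RKMethod.c]

theorem hasExpansion_quadErr (q : ℕ) :
    HasExpansion R.treeSet q (fun κ : StepData.{u} R p L M h₀ => κ.quadErr) := by
  simp only [quadErr_eq]
  refine HasExpansion.sum _ fun k hk =>
    HasExpansion.of_mem (isO_quadErr_term (Finset.mem_range.mp hk)) fun κ => ?_
  refine Submodule.smul_mem _ _ ?_
  -- k = 0 corresponds to τ₀, which `treeSet` excludes; its residual vanishes because c = A𝟙.
  rcases Nat.eq_zero_or_pos k with rfl | hk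
  · have : (tensorVec (R.sHat (0 + 1)) (κ.P.yDeriv (0 + 1) κ.t) : Fin s → κ.E) = 0 := by
      ext i
      rw [tensorVec, zero_add, sHat_one]
      simp
    rw [this]
    exact Submodule.zero_mem _
  · refine tensorVec_mem_tensorSpan (S := R.treeSet (k + 1))
      ⟨.bushy k, by simp [RKTree.IsStandard], ?_, by rw [RKTree.size], ?_⟩ _
    · rw [RKTree.single, Ne, RKTree.bushy.injEq]
      omega
    · simpa using R.pow_mulVec_sHat_mem_V k 0

/-- The nonlinearity is well approximated along the Taylor polynomial of the solution. -/
theorem isO_g_Yhat_sub (hp : 1 ≤ p) : IsO p (fun κ : StepData.{u} R p L M h₀ =>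
    fun i : Fin s => κ.P.g (κ.Yhat i) -
      taylorCurve p (fun k => κ.P.gyDeriv k κ.t) (R.c i * κ.h)) := by
  obtain ⟨C, hC, hb⟩ := SemilinearIVP.exists_norm_g_yCurve_sub_le.{u} p hp L M (∑ i, |R.c i|)
  refine IsO.of_forall_stage (C := C * (∑ i, |R.c i|) ^ p)
    (mul_nonneg hC (pow_nonneg (Finset.sum_nonneg fun _ _ => abs_nonneg _) p)) fun κ i => ?_
  refine (hb κ.E κ.P κ.assumption κ.t κ.mem _ (κ.abs_c_mul_h_le i)).trans ?_
  rw [mul_assoc]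
  exact mul_le_mul_of_nonneg_left (κ.abs_c_mul_h_pow_le p i) hC

theorem norm_kron_id_le (κ : StepData.{u} R p L M h₀) (U : Fin s → κ.E) :
    ‖kron R.A (ContinuousLinearMap.id ℝ κ.E) U‖ ≤ (∑ i, ∑ j, |R.A i j|) * ‖U‖ := by
  refine (norm_kron_le _ _ _).trans ?_
  refine mul_le_mul_of_nonneg_left ?_
    (Finset.sum_nonneg fun i _ => Finset.sum_nonneg fun j _ => abs_nonneg _)
  exact mul_le_of_le_one_left (norm_nonneg _) ContinuousLinearMap.norm_id_le

theorem isO_err (hp : 1 ≤ p) {K : ℝ} (hK : 0 ≤ K)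
    (hres : ∀ (E : Type u) [NormedAddCommGroup E] [InnerProductSpace ℝ E]
      [FiniteDimensional ℝ E] (Z : E →L[ℝ] E), IsDissipative Z → ∀ U : Fin s → E,
      ‖U‖ ≤ K * ‖R.stageOp Z U‖)
    (hL : 0 ≤ L) (hsmall : K * (∑ i, ∑ j, |R.A i j|) * L * h₀ ≤ 1 / 2) :
    IsO 1 (fun κ : StepData.{u} R p L M h₀ => κ.err) := by
  obtain ⟨C₁, hC₁, h1⟩ := isO_quadErr (R := R) (p := p) (L := L) (M := M) (h₀ := h₀)
  obtain ⟨C₂, hC₂, h2⟩ := (isO_lastErr (R := R) (L := L) (M := M) (h₀ := h₀) hp).mono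
    (show 1 ≤ p + 1 by omega)
  obtain ⟨C₃, hC₃, h3⟩ := (isO_g_Yhat_sub (R := R) (L := L) (M := M) (h₀ := h₀) hp).mono
    (Nat.zero_le p)
  set a := ∑ i, ∑ j, |R.A i j| with ha
  have ha0 : 0 ≤ a := Finset.sum_nonneg fun i _ => Finset.sum_nonneg fun j _ => abs_nonneg _
  -- The factor 2 comes from absorbing K a L h ‖err‖ ≤ ½ ‖err‖ into the left side.
  refine ⟨2 * (K * (C₁ + a * C₃ + C₂)), by positivity, fun κ => ?_⟩
  have hh := κ.h_nonneg
  have hg : ‖κ.gErr‖ ≤ L * ‖κ.err‖ + C₃ := by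
    have e : κ.gErr = (fun i => κ.P.g (κ.Y i) - κ.P.g (κ.Yhat i)) + fun i => κ.P.g (κ.Yhat i) -
        taylorCurve p (fun k => κ.P.gyDeriv k κ.t) (R.c i * κ.h) := by
      ext i; simp [gErr]
    rw [e]
    refine (norm_add_le _ _).trans (add_le_add ?_ (by simpa using h3 κ))
    refine (pi_norm_le_iff_of_nonneg (by positivity)).mpr fun i => ?_
    refine (κ.assumption.lipschitz _ _).trans ?_
    gcongr
    exact norm_le_pi_norm κ.err i
  have hk : ‖κ.h • kron R.A (ContinuousLinearMap.id ℝ κ.E) κ.gErr‖ ≤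
      κ.h * (a * (L * ‖κ.err‖ + C₃)) := by
    rw [norm_smul, Real.norm_eq_abs, abs_of_nonneg hh]
    gcongr
    exact (norm_kron_id_le κ _).trans (mul_le_mul_of_nonneg_left hg ha0)
  have key := hres κ.E _ κ.dissipative κ.err
  have h4 : ‖R.stageOp (κ.h • κ.P.J) κ.err‖ ≤
      C₁ * κ.h ^ 1 + κ.h * (a * (L * ‖κ.err‖ + C₃)) + C₂ * κ.h ^ 1 := by
    rw [κ.stageOp_err]
    refine (norm_add₃_le).trans ?_
    rw [norm_neg]
    exact add_le_add (add_le_add (h1 κ) hk) (h2 κ)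
  have h5 : ‖κ.err‖ ≤ K * (C₁ * κ.h ^ 1 + κ.h * (a * (L * ‖κ.err‖ + C₃)) + C₂ * κ.h ^ 1) :=
    key.trans (mul_le_mul_of_nonneg_left h4 hK)
  have h6 : K * a * L * κ.h * ‖κ.err‖ ≤ 1 / 2 * ‖κ.err‖ := by
    refine mul_le_mul_of_nonneg_right (le_trans ?_ hsmall) (norm_nonneg _)
    exact mul_le_mul_of_nonneg_left κ.h_le (by positivity)
  rw [pow_one] at h5 ⊢
  nlinarith

end StepData

/-! ### Expansion of the error of the nonlinearity. -/

namespace StepData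

variable {s : ℕ} {R : RKMethod s} {p : ℕ} {L M h₀ : ℝ}

/-- The `m`-th term of the Taylor expansion of `g` about `y t`, in every stage. -/
noncomputable def gTerm (κ : StepData.{u} R p L M h₀) (m : ℕ) (w : Fin s → κ.E) : Fin s → κ.E :=
  (m.factorial : ℝ)⁻¹ • blockMap s (iteratedFDeriv ℝ m κ.P.g (κ.P.y κ.t)) (fun _ => w)

theorem IsO.blockMap {m : ℕ} (hm : 1 ≤ m) (hmp : m ≤ p) {n : Fin m → ℕ}
    {U : Fin m → ∀ κ : StepData.{u} R p L M h₀, Fin s → κ.E} (hU : ∀ j, IsO (n j) (U j)) :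
    IsO (∑ j, n j) (fun κ : StepData.{u} R p L M h₀ =>
      blockMap s (iteratedFDeriv ℝ m κ.P.g (κ.P.y κ.t)) (fun j => U j κ)) := by
  choose C hC h using hU
  refine IsO.of_forall_stage (C := |M| * ∏ j, C j)
    (mul_nonneg (abs_nonneg _) (Finset.prod_nonneg fun j _ => hC j)) fun κ i => ?_
  rw [blockMap_apply]
  refine (ContinuousMultilinearMap.le_opNorm _ _).trans ?_
  rw [mul_assoc, ← Finset.prod_pow_eq_pow_sum, ← Finset.prod_mul_distrib]
  refine mul_le_mul ((κ.assumption.g_bound m hm hmp _).trans (le_abs_self M))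
    (Finset.prod_le_prod (fun _ _ => norm_nonneg _) fun j _ => ?_)
    (Finset.prod_nonneg fun _ _ => norm_nonneg _) (abs_nonneg _)
  exact (norm_le_pi_norm (U j κ) i).trans (h j κ)

theorem isO_g_sub_sum_gTerm (hp : 1 ≤ p) {w : ∀ κ : StepData.{u} R p L M h₀, Fin s → κ.E}
    (hw : IsO 1 w) : IsO p (fun κ : StepData.{u} R p L M h₀ =>
      (fun i => κ.P.g (κ.P.y κ.t + w κ i)) - ∑ m ∈ Finset.range p, κ.gTerm m (w κ)) := by
  obtain ⟨C, hC, h⟩ := hw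
  refine IsO.of_forall_stage (C := |M| * C ^ p) (by positivity) fun κ i => ?_
  have key := norm_sub_sum_iteratedFDeriv_le hp κ.assumption.g_smooth
    (fun x => κ.assumption.g_bound p hp le_rfl x) (κ.P.y κ.t) (w κ i)
  have hwi : ‖w κ i‖ ≤ C * κ.h := by
    have := (norm_le_pi_norm (w κ) i).trans (h κ)
    rwa [pow_one] at this
  rw [Pi.sub_apply, Finset.sum_apply]
  refine key.trans ?_
  rw [mul_assoc, ← mul_pow]
  have : M * ‖w κ i‖ ^ p ≤ |M| * ‖w κ i‖ ^ p := by gcongr; exact le_abs_self M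
  refine this.trans ?_
  gcongr

/-- Replacing a perturbation `w` of the Taylor polynomial terms by `w + e` changes the nonlinearity
by terms belonging to trees. -/
theorem hasExpansion_gTerm_add_sub (q : ℕ) {m : ℕ} (hmp : m ≤ p)
    {W Z : ℕ → ∀ κ : StepData.{u} R p L M h₀, Fin s → κ.E}
    (hW : ∀ n, IsO n (W n)) (hWc : ∀ n κ, W n κ ∈ tensorSpan κ.E {R.c ^ n})
    (hZ : ∀ n, IsO n (Z n)) (hZt : ∀ n κ, Z n κ ∈ tensorSpan κ.E (R.treeSet n)) (B : Finset ℕ) :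
    HasExpansion R.graftSet q (fun κ : StepData.{u} R p L M h₀ =>
      κ.gTerm m (∑ n ∈ B, W n κ + ∑ n ∈ B, Z n κ) - κ.gTerm m (∑ n ∈ B, W n κ)) := by
  classical
  -- Multilinear expansion: `A` is the set of slots filled from `W`, and `r` picks the term in each
  -- slot. The summand A = univ is the subtracted one, so every remaining product has a factor from
  -- `Z`.
  have e : ∀ κ : StepData.{u} R p L M h₀,
      κ.gTerm m (∑ n ∈ B, W n κ + ∑ n ∈ B, Z n κ) - κ.gTerm m (∑ n ∈ B, W n κ) =
      ∑ A ∈ Finset.univ.erase (Finset.univ : Finset (Fin m)),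
        ∑ r ∈ Fintype.piFinset (fun _ : Fin m => B), (m.factorial : ℝ)⁻¹ •
          blockMap s (iteratedFDeriv ℝ m κ.P.g (κ.P.y κ.t))
            (fun j => if j ∈ A then W (r j) κ else Z (r j) κ) := by
    intro κ
    have h1 : (fun _ : Fin m => ∑ n ∈ B, W n κ + ∑ n ∈ B, Z n κ) =
      (fun _ => ∑ n ∈ B, W n κ) + (fun _ => ∑ n ∈ B, Z n κ) := rfl
    simp only [← Finset.smul_sum]
    rw [gTerm, gTerm, h1, MultilinearMap.map_add_univ, ← smul_sub,
      ← Finset.sum_erase_add _ _ (Finset.mem_univ (Finset.univ : Finset (Fin m))),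
      Finset.piecewise_univ, add_sub_cancel_right]
    congr 1
    refine Finset.sum_congr rfl fun A _ => ?_
    rw [← MultilinearMap.map_sum_finset _ (fun j n => if j ∈ A then W n κ else Z n κ)]
    congr 1
    funext j
    by_cases hj : j ∈ A <;> simp [Finset.piecewise, hj]
  simp only [e]
  refine HasExpansion.sum _ fun A hA => HasExpansion.sum _ fun r _ => ?_
  have hA' : A ≠ Finset.univ := (Finset.mem_erase.mp hA).1
  -- For m = 0 the only subset is univ; excluding it keeps the unbounded zeroth derivative of `g`
  -- out of the estimates.
  have hm : 1 ≤ m := by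
    by_contra! h0
    obtain rfl : m = 0 := by omega
    exact hA' (Subsingleton.elim _ _)
  refine HasExpansion.of_mem (n := ∑ j, r j) ?_ fun κ => Submodule.smul_mem _ _ ?_
  · refine (IsO.blockMap hm hmp (n := r)
      (U := fun j κ => if j ∈ A then W (r j) κ else Z (r j) κ) fun j => ?_).of_norm_le
      (K := ‖((m.factorial : ℝ)⁻¹)‖) (norm_nonneg _) fun κ => (norm_smul_le _ _)
    by_cases hj : j ∈ A
    · simpa [hj] using hW (r j)
    · simpa [hj] using hZ (r j)
  · refine blockMap_mem_tensorSpan _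
      (S := fun j => if j ∈ A then {R.c ^ r j} else R.treeSet (r j)) ?_ fun j => ?_
    · intro β hβ
      refine R.prod_mem_graftSet hA' r (fun i hi => ?_) fun i hi => ?_
      · have := hβ i
        rw [if_pos hi] at this
        exact this
      · have := hβ i
        rwa [if_neg hi] at this
    · by_cases hj : j ∈ A
      · simpa only [if_pos hj] using hWc (r j) κ
      · simpa only [if_neg hj] using hZt (r j) κ

/-- The terms of the Taylor polynomial of the solution. -/
noncomputable def yTerm (n : ℕ) (κ : StepData.{u} R p L M h₀) : Fin s → κ.E :=
  if 1 ≤ n ∧ n ≤ p then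
    κ.h ^ n • tensorVec (R.c ^ n) ((n.factorial : ℝ)⁻¹ • κ.P.yDeriv n κ.t)
  else 0

theorem isO_yTerm (n : ℕ) : IsO n (yTerm (R := R) (p := p) (L := L) (M := M) (h₀ := h₀) n) := by
  by_cases hn : 1 ≤ n ∧ n ≤ p
  · have h1 := (isO_yDeriv (R := R) (p := p) (L := L) (M := M) (h₀ := h₀) hn.1 (by omega)).of_norm_le
      (Y := fun κ => (n.factorial : ℝ)⁻¹ • κ.P.yDeriv n κ.t) (norm_nonneg (n.factorial : ℝ)⁻¹)
      fun κ => norm_smul_le _ _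
    have h2 := (h1.tensorVec (R.c ^ n)).pow_smul n
    rw [zero_add] at h2
    unfold yTerm
    simpa only [if_pos hn] using h2
  · unfold yTerm
    simpa only [if_neg hn] using IsO.zero n

theorem yTerm_mem (n : ℕ) (κ : StepData.{u} R p L M h₀) :
    yTerm n κ ∈ tensorSpan κ.E {R.c ^ n} := by
  rw [yTerm]
  split_ifs
  · exact Submodule.smul_mem _ _ (tensorVec_mem_tensorSpan (Set.mem_singleton _) _)
  · exact Submodule.zero_mem _

theorem y_add_sum_yTerm (κ : StepData.{u} R p L M h₀) (i : Fin s) :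
    κ.P.y κ.t + (∑ n ∈ Finset.range (p + 1), yTerm n κ) i = κ.Yhat i := by
  have h0 : yTerm 0 κ = 0 := by simp [yTerm]
  rw [Yhat, yCurve_eq, Finset.sum_range_succ', h0, add_zero, Finset.sum_apply]
  congr 1
  refine Finset.sum_congr rfl fun k hk => ?_
  rw [yTerm, if_pos ⟨by omega, by simpa using hk⟩, Pi.smul_apply, tensorVec, Pi.pow_apply,
    smul_smul, smul_smul]
  congr 1
  ring

theorem isO_sum_yTerm : IsO 1 (fun κ : StepData.{u} R p L M h₀ =>
    ∑ n ∈ Finset.range (p + 1), yTerm n κ) := by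
  refine IsO.sum _ fun n _ => ?_
  rcases Nat.eq_zero_or_pos n with rfl | hn
  · have : yTerm (R := R) (p := p) (L := L) (M := M) (h₀ := h₀) 0 = fun _ => 0 := by
      funext κ; simp [yTerm]
    rw [this]
    exact IsO.zero 1
  · exact (isO_yTerm n).mono hn

/-- With w the Taylor terms of the solution and e the truncated expansion of `err`, the differences
of the Taylor terms of g at w + e and at w give the tree terms. The rest is O(h^q): a Lipschitz
error from truncating `err`, two Taylor remainders of g, and the defect of g along the Taylor
polynomial. -/
theorem hasExpansion_gErr (hp : 1 ≤ p) {q : ℕ} (hq : 1 ≤ q) (hqp : q ≤ p)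
    (he1 : IsO 1 (fun κ : StepData.{u} R p L M h₀ => κ.err))
    (he : HasExpansion R.treeSet q (fun κ : StepData.{u} R p L M h₀ => κ.err)) :
    HasExpansion R.graftSet q (fun κ : StepData.{u} R p L M h₀ => κ.gErr) := by
  obtain ⟨X, hX, hXt, hrem⟩ := he
  -- Cutting the terms off at q lets both sums run over the same range p + 1.
  let Z : ℕ → ∀ κ : StepData.{u} R p L M h₀, Fin s → κ.E := fun n κ => if n < q then X n κ else 0
  have hZ : ∀ n, IsO n (Z n) := fun n => by
    by_cases hn : n < q
    · simpa only [Z, if_pos hn] using hX n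
    · simpa only [Z, if_neg hn] using IsO.zero n
  have hZt : ∀ n κ, Z n κ ∈ tensorSpan κ.E (R.treeSet n) := fun n κ => by
    by_cases hn : n < q
    · simpa only [Z, if_pos hn] using hXt n κ
    · simp only [Z, if_neg hn]; exact Submodule.zero_mem _
  have hsum : ∀ κ, ∑ n ∈ Finset.range q, X n κ = ∑ n ∈ Finset.range (p + 1), Z n κ := fun κ => by
    rw [← Finset.sum_subset (Finset.range_subset_range.mpr (show q ≤ p + 1 by omega))
      (fun n _ hn => if_neg (by simpa using hn))]
    exact Finset.sum_congr rfl fun n hn => (if_pos (Finset.mem_range.mp hn)).symm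
  simp only [hsum] at hrem
  set w : ∀ κ : StepData.{u} R p L M h₀, Fin s → κ.E :=
    fun κ => ∑ n ∈ Finset.range (p + 1), yTerm n κ with hw
  set e : ∀ κ : StepData.{u} R p L M h₀, Fin s → κ.E :=
    fun κ => ∑ n ∈ Finset.range (p + 1), Z n κ with hedef
  have hwO : IsO 1 w := isO_sum_yTerm
  have heO : IsO 1 e := by
    have := he1.sub (hrem.mono hq)
    simpa only [sub_sub_cancel] using this
  have hlip : IsO q (fun κ : StepData.{u} R p L M h₀ => (fun i => κ.P.g (κ.Y i)) -
      fun i => κ.P.g (κ.P.y κ.t + (w κ + e κ) i)) := by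
    refine hrem.of_norm_le (abs_nonneg L) fun κ => ?_
    refine (pi_norm_le_iff_of_nonneg (by positivity)).mpr fun i => ?_
    refine (κ.assumption.lipschitz _ _).trans ?_
    have h1 : κ.Y i - (κ.P.y κ.t + (w κ + e κ) i) = (κ.err - e κ) i := by
      rw [Pi.add_apply, ← add_assoc, y_add_sum_yTerm, Pi.sub_apply, err]
      abel
    rw [h1]
    exact mul_le_mul (le_abs_self L) (norm_le_pi_norm (κ.err - e κ) i) (norm_nonneg _)
      (abs_nonneg _)
  have hT1 := isO_g_sub_sum_gTerm hp (hwO.add heO)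
  have hT2 := isO_g_sub_sum_gTerm hp hwO
  have hG := isO_g_Yhat_sub (R := R) (L := L) (M := M) (h₀ := h₀) hp
  have hmain : HasExpansion R.graftSet q (fun κ : StepData.{u} R p L M h₀ =>
      ∑ m ∈ Finset.range p, (κ.gTerm m (w κ + e κ) - κ.gTerm m (w κ))) :=
    HasExpansion.sum _ fun m hm => hasExpansion_gTerm_add_sub q (Finset.mem_range.mp hm).le
      isO_yTerm yTerm_mem hZ hZt _
  have hrest := HasExpansion.of_isO (S := R.graftSet)
    (hlip.add (((hT1.sub hT2).add hG).mono hqp))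
  convert hmain.add hrest using 1
  funext κ
  ext i
  have h2 : κ.P.y κ.t + w κ i = κ.Yhat i := y_add_sum_yTerm κ i
  change κ.gErr i = (∑ m ∈ Finset.range p, (κ.gTerm m (w κ + e κ) - κ.gTerm m (w κ))) i +
    ((κ.P.g (κ.Y i) - κ.P.g (κ.P.y κ.t + (w κ + e κ) i)) +
    (((κ.P.g (κ.P.y κ.t + (w κ + e κ) i) - (∑ m ∈ Finset.range p, κ.gTerm m (w κ + e κ)) i) -
    (κ.P.g (κ.P.y κ.t + w κ i) - (∑ m ∈ Finset.range p, κ.gTerm m (w κ)) i)) +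
    (κ.P.g (κ.Yhat i) - taylorCurve p (fun k => κ.P.gyDeriv k κ.t) (R.c i * κ.h))))
  rw [Finset.sum_sub_distrib, Pi.sub_apply, h2, gErr]
  abel

end StepData

/-! ### Commutation identities and solvability of the stage equations. -/

namespace RKMethod

variable {s : ℕ} {R : RKMethod s} {E : Type u} [NormedAddCommGroup E] [InnerProductSpace ℝ E]

theorem IsASIStable.stageOpInv_stageOp (h : R.IsASIStable) [FiniteDimensional ℝ E]
    {Z : E →L[ℝ] E} (hZ : IsDissipative Z) (U : Fin s → E) :
    R.stageOpInv Z (R.stageOp Z U) = U :=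
  h.stageOp_injective hZ (h.stageOp_stageOpInv hZ _)

theorem stageOp_kron_id (R : RKMethod s) (Z : E →L[ℝ] E) (U : Fin s → E) :
    R.stageOp Z (kron R.A (ContinuousLinearMap.id ℝ E) U) =
      kron R.A (ContinuousLinearMap.id ℝ E) (R.stageOp Z U) := by
  ext i
  simp only [stageOp_apply, kron_apply, ContinuousLinearMap.id_apply, smul_sub,
    Finset.sum_sub_distrib, map_sum, map_smul]

/-- (bᵀ⊗Z)(A⊗I) = (bᵀ⊗I)(A⊗Z), and A⊗Z is I minus the stage operator. This trades the unbounded `Z`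
in the error formula for bounded operators. -/
theorem kronRow_kron_id (R : RKMethod s) (Z : E →L[ℝ] E) (U : Fin s → E) :
    kronRow R.b Z (kron R.A (ContinuousLinearMap.id ℝ E) U) =
      kronRow R.b (ContinuousLinearMap.id ℝ E) (U - R.stageOp Z U) := by
  simp only [kronRow_apply, kron_apply, ContinuousLinearMap.id_apply, Pi.sub_apply, stageOp_apply,
    sub_sub_cancel, map_sum, map_smul]

/-- For a small step, the stage equations have exactly one solution. -/
theorem IsASIStable.existsUnique_isStageSolution (hASI : R.IsASIStable) [FiniteDimensional ℝ E]
    {K : ℝ} (hK : 0 ≤ K) {P : SemilinearIVP E} {p : ℕ} {L M h h₀ : ℝ}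
    (hres : ∀ Z : E →L[ℝ] E, IsDissipative Z → ∀ U : Fin s → E, ‖U‖ ≤ K * ‖R.stageOp Z U‖)
    (hP : P.Assumption p L M) (hh : 0 ≤ h) (hh₀ : h ≤ h₀)
    (hsmall : K * (∑ i, ∑ j, |R.A i j|) * L * h₀ ≤ 1 / 2) (y₀ : E) :
    ∃! Y : Fin s → E, R.IsStageSolution P.f h y₀ Y := by
  have : CompleteSpace E := FiniteDimensional.complete ℝ E
  have hZ : IsDissipative (h • P.J) :=
    (IsDissipative.of_logNorm_nonpos hP.logNorm_nonpos).smul hh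
  have hL := hP.L_pos.le
  set a := ∑ i, ∑ j, |R.A i j| with ha
  have ha0 : 0 ≤ a := Finset.sum_nonneg fun i _ => Finset.sum_nonneg fun j _ => abs_nonneg _
  let G : (Fin s → E) → Fin s → E := fun Y => (fun _ => y₀) +
    h • kron R.A (ContinuousLinearMap.id ℝ E) (fun i => P.g (Y i))
  -- The linear part is solved exactly, so the contraction constant involves L but not ‖J‖.
  let Φ : (Fin s → E) → Fin s → E := fun Y => R.stageOpInv (h • P.J) (G Y)
  have hiff : ∀ Y, R.IsStageSolution P.f h y₀ Y ↔ Φ Y = Y := by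
    intro Y
    have h1 : Φ Y = Y ↔ R.stageOp (h • P.J) Y = G Y := by
      constructor
      · intro hY
        rw [← hY, hASI.stageOp_stageOpInv hZ, hY]
      · intro hY
        change R.stageOpInv _ (G Y) = Y
        rw [← hY, hASI.stageOpInv_stageOp hZ]
    rw [h1, funext_iff]
    refine forall_congr' fun i => ?_
    have h2 : G Y i = y₀ + h • ∑ j, R.A i j • P.g (Y j) := by
      simp [G, kron_apply]
    rw [h2, stageOp_apply, sub_eq_iff_eq_add]
    simp only [SemilinearIVP.f, smul_add, Finset.sum_add_distrib, smul_apply, smul_comm _ h,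
      Finset.smul_sum]
    rw [add_assoc, add_comm (∑ j, h • R.A i j • P.J (Y j))]
  have hcontr : ContractingWith (1 / 2) Φ := by
    refine ⟨by rw [← NNReal.coe_lt_coe]; norm_num, LipschitzWith.of_dist_le_mul fun U V => ?_⟩
    rw [dist_eq_norm, dist_eq_norm]
    have e1 : Φ U - Φ V = R.stageOpInv (h • P.J) (h • kron R.A (ContinuousLinearMap.id ℝ E)
        (fun i => P.g (U i) - P.g (V i))) := by
      have e2 : (fun i => P.g (U i) - P.g (V i)) =
        (fun i => P.g (U i)) - fun i => P.g (V i) := rfl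
      rw [e2, map_sub, smul_sub]
      simp only [Φ, G, ← map_sub, add_sub_add_left_eq_sub]
    have e3 := hres _ hZ (Φ U - Φ V)
    rw [e1, hASI.stageOp_stageOpInv hZ, norm_smul, Real.norm_eq_abs, abs_of_nonneg hh] at e3
    rw [e1]
    have e4 : ‖fun i => P.g (U i) - P.g (V i)‖ ≤ L * ‖U - V‖ := by
      refine (pi_norm_le_iff_of_nonneg (by positivity)).mpr fun i => ?_
      refine (hP.lipschitz _ _).trans ?_
      gcongr
      exact norm_le_pi_norm (U - V) i
    have e5 : ‖kron R.A (ContinuousLinearMap.id ℝ E) (fun i => P.g (U i) - P.g (V i))‖ ≤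
        a * (L * ‖U - V‖) := by
      refine (norm_kron_le _ _ _).trans (mul_le_mul_of_nonneg_left ?_ ha0)
      exact (mul_le_of_le_one_left (norm_nonneg _) ContinuousLinearMap.norm_id_le).trans e4
    calc _ ≤ K * (h * (a * (L * ‖U - V‖))) := e3.trans (by gcongr)
      _ = (K * a * L * h) * ‖U - V‖ := by ring
      _ ≤ 1 / 2 * ‖U - V‖ := by
        refine mul_le_mul_of_nonneg_right (le_trans ?_ hsmall) (norm_nonneg _)
        gcongr
      _ = _ := by norm_num
  refine ⟨ContractingWith.fixedPoint Φ hcontr, (hiff _).mpr hcontr.fixedPoint_isFixedPt,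
    fun Y hY => hcontr.fixedPoint_unique ((hiff Y).mp hY)⟩

end RKMethod

/-! ### The bootstrap and the local error. -/

namespace StepData

variable {s : ℕ} {R : RKMethod s} {p : ℕ} {L M h₀ : ℝ}

theorem norm_stageOpInv_le (hASI : R.IsASIStable) {K : ℝ}
    (hres : ∀ (E : Type u) [NormedAddCommGroup E] [InnerProductSpace ℝ E]
      [FiniteDimensional ℝ E] (Z : E →L[ℝ] E), IsDissipative Z → ∀ U : Fin s → E,
      ‖U‖ ≤ K * ‖R.stageOp Z U‖) (κ : StepData.{u} R p L M h₀) (U : Fin s → κ.E) :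
    ‖R.stageOpInv (κ.h • κ.P.J) U‖ ≤ K * ‖U‖ := by
  have := hres κ.E _ κ.dissipative (R.stageOpInv (κ.h • κ.P.J) U)
  rwa [hASI.stageOp_stageOpInv κ.dissipative] at this

/-- Induction on q starting from the a priori bound: the expansion of `gErr` to order q gains one
order from h, A maps `graftSet` into `treeSet`, and the resolvent preserves `treeSet` tensors with a
uniform bound. -/
theorem hasExpansion_err (hp : 1 ≤ p) (hASI : R.IsASIStable) {K : ℝ} (hK : 0 ≤ K)
    (hres : ∀ (E : Type u) [NormedAddCommGroup E] [InnerProductSpace ℝ E]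
      [FiniteDimensional ℝ E] (Z : E →L[ℝ] E), IsDissipative Z → ∀ U : Fin s → E,
      ‖U‖ ≤ K * ‖R.stageOp Z U‖)
    (he1 : IsO 1 (fun κ : StepData.{u} R p L M h₀ => κ.err)) {q : ℕ} (hq : 1 ≤ q) (hqp : q ≤ p) :
    HasExpansion R.treeSet q (fun κ : StepData.{u} R p L M h₀ => κ.err) := by
  induction q, hq using Nat.le_induction with
  | base => exact .of_isO he1
  | succ q hq ih =>
    have hN := hasExpansion_gErr hp hq (by omega) he1 (ih (by omega))
    have h1 := hN.smul_map (T := R.treeSet)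
      (fun κ => kron R.A (ContinuousLinearMap.id ℝ κ.E))
      (Finset.sum_nonneg fun i _ => Finset.sum_nonneg fun j _ => abs_nonneg _)
      (fun κ U => norm_kron_id_le κ U)
      (fun n κ U hU => kron_mem_tensorSpan (fun β hβ => R.mulVec_mem_treeSet_of_graftSet hβ) _ hU)
    have h2 := (hasExpansion_quadErr (R := R) (p := p) (L := L) (M := M) (h₀ := h₀) (q + 1)).map
      (T := R.treeSet) (fun κ => -ContinuousLinearMap.id ℝ (Fin s → κ.E)) zero_le_one
      (fun κ U => by simp) (fun n κ U hU => by simpa using hU)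
    have h3 := HasExpansion.of_isO (S := R.treeSet)
      ((isO_lastErr (R := R) (L := L) (M := M) (h₀ := h₀) hp).mono (show q + 1 ≤ p + 1 by omega))
    have h4 := ((h2.add h1).add h3).map (T := R.treeSet)
      (fun κ => R.stageOpInv (κ.h • κ.P.J)) hK (norm_stageOpInv_le hASI hres)
      (fun n κ U hU => hASI.stageOpInv_mem_tensorSpan κ.dissipative
        (fun β hβ => R.mulVec_mem_treeSet hβ) hU)
    convert h4 using 1
    funext κ
    have := hASI.stageOpInv_stageOp κ.dissipative κ.err
    rw [κ.stageOp_err] at this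
    exact this.symm

/-- Up to powers of h, the resolvent of each summand is Ψ_τ for τ = [τ₀^k], which the order
condition annihilates. -/
theorem kronRow_stageOpInv_quadErr (hASI : R.IsASIStable) (hord : R.HasSemilinearOrder p)
    (κ : StepData.{u} R p L M h₀) :
    kronRow R.b (κ.h • κ.P.J) (R.stageOpInv (κ.h • κ.P.J) κ.quadErr) = 0 := by
  rw [quadErr_eq, map_sum, map_sum]
  refine Finset.sum_eq_zero fun k hk => ?_
  rw [map_smul, map_smul]
  have hτ := hord.2 (.bushy k) (by simp [RKTree.IsStandard])
    (by rw [RKTree.size]; exact Finset.mem_range.mp hk)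
  have := kronRow_eq_zero_of_mem hτ.2 (κ.h • κ.P.J)
    (R.stagePsi_mem_tensorSpan hASI κ.dissipative κ.P κ.t (.bushy k))
  rw [RKMethod.stagePsi] at this
  rw [this, smul_zero]

/-- The error of one step, before estimating. -/
theorem yCurve_sub_step (hASI : R.IsASIStable) (hord : R.HasSemilinearOrder p)
    (κ : StepData.{u} R p L M h₀) :
    κ.P.yCurve p κ.t κ.h - R.step κ.P.f κ.h (κ.P.y κ.t) κ.Y =
    -(κ.h • kronRow R.b (ContinuousLinearMap.id ℝ κ.E) (R.stageOpInv (κ.h • κ.P.J) κ.gErr)) -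
    kronRow R.b (κ.h • κ.P.J) (R.stageOpInv (κ.h • κ.P.J) κ.lastErr) -
    (κ.h ^ (p + 1) * ((p.factorial : ℝ)⁻¹ * (R.b ⬝ᵥ R.c ^ p))) • κ.P.J (κ.P.yDeriv p κ.t) := by
  have hZ := κ.dissipative
  set W := R.stageOpInv (κ.h • κ.P.J) κ.gErr with hW
  have hWe : R.stageOp (κ.h • κ.P.J) W = κ.gErr := hASI.stageOp_stageOpInv hZ _
  have herr : κ.err = -R.stageOpInv (κ.h • κ.P.J) κ.quadErr +
      κ.h • kron R.A (ContinuousLinearMap.id ℝ κ.E) W +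
      R.stageOpInv (κ.h • κ.P.J) κ.lastErr := by
    apply hASI.stageOp_injective hZ
    rw [κ.stageOp_err, map_add, map_add, map_neg, hASI.stageOp_stageOpInv hZ,
      hASI.stageOp_stageOpInv hZ, map_smul, RKMethod.stageOp_kron_id, hWe]
  -- The term -bᵀ gErr produced here cancels the direct contribution of `gErr` to the step, leaving
  -- only its resolvent.
  have hrow : kronRow R.b (κ.h • κ.P.J) κ.err =
      κ.h • (kronRow R.b (ContinuousLinearMap.id ℝ κ.E) W -
        kronRow R.b (ContinuousLinearMap.id ℝ κ.E) κ.gErr) +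
      kronRow R.b (κ.h • κ.P.J) (R.stageOpInv (κ.h • κ.P.J) κ.lastErr) := by
    conv_lhs => rw [herr]
    rw [map_add, map_add, map_neg, kronRow_stageOpInv_quadErr hASI hord, neg_zero, zero_add,
      map_smul, RKMethod.kronRow_kron_id, map_sub, hWe]
  have hJ : κ.h • ∑ j, R.b j • κ.P.J (κ.err j) = kronRow R.b (κ.h • κ.P.J) κ.err := by
    simp only [kronRow_apply, smul_apply, smul_comm _ κ.h, Finset.smul_sum]
  have hq : ∑ k ∈ Finset.range p, (((k + 1).factorial : ℝ)⁻¹ * κ.h ^ (k + 1)) •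
      κ.P.yDeriv (k + 1) κ.t = ∑ k ∈ Finset.range p,
      (κ.h ^ (k + 1) * ((k.factorial : ℝ)⁻¹ * (R.b ⬝ᵥ R.c ^ k))) • κ.P.yDeriv (k + 1) κ.t := by
    refine Finset.sum_congr rfl fun k hk => ?_
    have hτ := (hord.2 (.bushy k) (by simp [RKTree.IsStandard])
      (by rw [RKTree.size]; exact Finset.mem_range.mp hk)).1
    rw [RKMethod.qHat, Nat.add_sub_cancel, sub_eq_zero, one_div] at hτ
    rw [hτ]
    congr 1
    ring
  have hgE : ∑ j, R.b j • κ.gErr j = kronRow R.b (ContinuousLinearMap.id ℝ κ.E) κ.gErr := by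
    simp [kronRow_apply]
  rw [yCurve_eq, RKMethod.step, smul_sum_f_Y, hJ, hrow, hq, hgE, smul_sub]
  abel

theorem isO_kronRow_of_hasExpansion (hord : R.HasSemilinearOrder p)
    {W : ∀ κ : StepData.{u} R p L M h₀, Fin s → κ.E} (hW : HasExpansion R.graftSet p W) :
    IsO p (fun κ : StepData.{u} R p L M h₀ =>
      kronRow R.b (ContinuousLinearMap.id ℝ κ.E) (W κ)) := by
  obtain ⟨Wn, -, h2, h3⟩ := hW
  have h4 : ∀ κ : StepData.{u} R p L M h₀, kronRow R.b (ContinuousLinearMap.id ℝ κ.E)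
      (W κ - ∑ n ∈ Finset.range p, Wn n κ) =
      kronRow R.b (ContinuousLinearMap.id ℝ κ.E) (W κ) := fun κ => by
    rw [map_sub, map_sum, Finset.sum_eq_zero, sub_zero]
    exact fun n hn => kronRow_eq_zero_of_mem
      (fun β hβ => hord.dotProduct_eq_zero (Finset.mem_range.mp hn) hβ) _ (h2 n κ)
  simp only [← h4]
  refine h3.of_norm_le (Finset.sum_nonneg fun j (_ : j ∈ Finset.univ) => abs_nonneg (R.b j))
    fun κ => (norm_kronRow_le _ _ _).trans ?_
  refine mul_le_mul_of_nonneg_left ?_ (Finset.sum_nonneg fun j _ => abs_nonneg _)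
  exact mul_le_of_le_one_left (norm_nonneg _) ContinuousLinearMap.norm_id_le

/-- The local error is `O(h ^ (p + 1))`. -/
theorem exists_norm_local_error_le (hAS : R.IsASStable) (hASI : R.IsASIStable)
    (hord : R.HasSemilinearOrder p) {K : ℝ} (hK : 0 ≤ K)
    (hres : ∀ (E : Type u) [NormedAddCommGroup E] [InnerProductSpace ℝ E]
      [FiniteDimensional ℝ E] (Z : E →L[ℝ] E), IsDissipative Z → ∀ U : Fin s → E,
      ‖U‖ ≤ K * ‖R.stageOp Z U‖)
    (hL : 0 ≤ L) (hsmall : K * (∑ i, ∑ j, |R.A i j|) * L * h₀ ≤ 1 / 2) :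
    ∃ D : ℝ, 0 ≤ D ∧ ∀ κ : StepData.{u} R p L M h₀, κ.t + κ.h ≤ κ.P.t_f →
      ‖κ.P.y (κ.t + κ.h) - R.step κ.P.f κ.h (κ.P.y κ.t) κ.Y‖ ≤ D * κ.h ^ (p + 1) := by
  have hp := hord.1
  obtain ⟨K', hK', hrow⟩ := hAS.exists_norm_kronRow_le.{u} hASI
  have he1 := isO_err (M := M) hp hK hres hL hsmall
  have hN := hasExpansion_gErr hp hp le_rfl he1 (hasExpansion_err hp hASI hK hres he1 hp le_rfl)
  have hW := isO_kronRow_of_hasExpansion hord (hN.map (T := R.graftSet)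
    (fun κ => R.stageOpInv (κ.h • κ.P.J)) hK (norm_stageOpInv_le hASI hres)
    (fun n κ U hU => hASI.stageOpInv_mem_tensorSpan κ.dissipative
      (fun β hβ => R.mulVec_mem_graftSet hβ) hU))
  have h1 := (hW.pow_smul 1).neg
  simp only [pow_one] at h1
  -- This is where the AS-stability bound enters: the row still contains `Z`.
  have h2 : IsO (p + 1) (fun κ : StepData.{u} R p L M h₀ =>
      kronRow R.b (κ.h • κ.P.J) (R.stageOpInv (κ.h • κ.P.J) κ.lastErr)) :=
    (isO_lastErr hp).of_norm_le hK' fun κ => by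
      have := hrow κ.E _ κ.dissipative (R.stageOpInv (κ.h • κ.P.J) κ.lastErr)
      rwa [hASI.stageOp_stageOpInv κ.dissipative] at this
  have h3 : IsO (p + 1) (fun κ : StepData.{u} R p L M h₀ =>
      (κ.h ^ (p + 1) * ((p.factorial : ℝ)⁻¹ * (R.b ⬝ᵥ R.c ^ p))) •
        κ.P.J (κ.P.yDeriv p κ.t)) := by
    have h4 := ((isO_J_yDeriv (R := R) (L := L) (M := M) (h₀ := h₀) hp).of_norm_le
      (Y := fun κ => ((p.factorial : ℝ)⁻¹ * (R.b ⬝ᵥ R.c ^ p)) • κ.P.J (κ.P.yDeriv p κ.t))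
      (norm_nonneg ((p.factorial : ℝ)⁻¹ * (R.b ⬝ᵥ R.c ^ p))) fun κ =>
        norm_smul_le _ _).pow_smul (p + 1)
    simpa only [zero_add, smul_smul] using h4
  obtain ⟨D, hD, hb⟩ := (h1.sub h2).sub h3
  refine ⟨|M| + D, by positivity, fun κ hκ => ?_⟩
  have h5 := κ.assumption.norm_y_sub_yCurve_le κ.mem κ.h_nonneg hκ
  have h6 := hb κ
  beta_reduce at h6
  rw [← yCurve_sub_step hASI hord] at h6
  have h7 : M * κ.h ^ (p + 1) ≤ |M| * κ.h ^ (p + 1) :=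
    mul_le_mul_of_nonneg_right (le_abs_self M) (pow_nonneg κ.h_nonneg _)
  have h8 := norm_add_le (κ.P.y (κ.t + κ.h) - κ.P.yCurve p κ.t κ.h)
    (κ.P.yCurve p κ.t κ.h - R.step κ.P.f κ.h (κ.P.y κ.t) κ.Y)
  rw [sub_add_sub_cancel] at h8
  rw [add_mul]
  linarith

end StepData

/-! ### Choice of the constants. -/

theorem theorem3p5 {s : ℕ} (R : RKMethod s) (hAS : R.IsASStable) (hASI : R.IsASIStable)
    (p : ℕ) (hp : R.HasSemilinearOrder p) (L M : ℝ) :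
    -- all elementary error terms up to order `p` are well defined and vanish, for `Z = h J`
    (∀ (E : Type u) [NormedAddCommGroup E] [InnerProductSpace ℝ E] [FiniteDimensional ℝ E]
      (P : SemilinearIVP E) (r : ℕ), p ≤ r → P.Assumption r L M →
      ∀ h : ℝ, 0 ≤ h →
        IsUnit (R.stageOp (h • P.J)) ∧
        ∀ τ : RKTree, τ.IsStandard → τ.size ≤ p → ∀ t ∈ Set.Icc P.t₀ P.t_f,
          R.psi P (h • P.J) t τ = 0) ∧
    -- local truncation error bound, with constants depending on the method, `L` and `M` only
    ∃ D > (0 : ℝ), ∃ hTilde > (0 : ℝ),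
      ∀ (E : Type u) [NormedAddCommGroup E] [InnerProductSpace ℝ E] [FiniteDimensional ℝ E]
        (P : SemilinearIVP E) (r : ℕ), p ≤ r → P.Assumption r L M →
        ∀ t ∈ Set.Icc P.t₀ P.t_f, ∀ h : ℝ, 0 ≤ h → h < hTilde →
          (∃! Y : Fin s → E, R.IsStageSolution P.f h (P.y t) Y) ∧
          ∀ Y : Fin s → E, R.IsStageSolution P.f h (P.y t) Y → t + h ≤ P.t_f →
            ‖P.y (t + h) - R.step P.f h (P.y t) Y‖ ≤ D * h ^ (p + 1) := by
  refine ⟨fun E _ _ _ P r hpr hP h hh => ?_, ?_⟩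
  · have hZ := (IsDissipative.of_logNorm_nonpos hP.logNorm_nonpos).smul hh
    exact ⟨hASI.isUnit_stageOp hZ, fun τ h1 h2 t _ => R.psi_eq_zero hASI hZ P t (hp.2 τ h1 h2)⟩
  obtain ⟨K, hK, hres⟩ := hASI.exists_norm_le.{u}
  -- For L ≤ 0 no problem satisfies the assumptions.
  rcases le_or_gt L 0 with hL | hL
  · exact ⟨1, one_pos, 1, one_pos, fun E _ _ _ P r _ hP =>
      absurd hP.L_pos (not_lt.mpr hL)⟩
  set a := ∑ i, ∑ j, |R.A i j| with ha
  have ha0 : 0 ≤ a := Finset.sum_nonneg fun i _ => Finset.sum_nonneg fun j _ => abs_nonneg _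
  -- The bound 1 allows powers of h to be compared; the second makes the Lipschitz part a
  -- contraction with factor ½, and its +1 keeps the denominator positive.
  set h₀ := min 1 (1 / (2 * (K * a * L + 1))) with hh₀
  have hpos : 0 < h₀ := lt_min one_pos (by positivity)
  have hsmall : K * a * L * h₀ ≤ 1 / 2 := by
    calc K * a * L * h₀ ≤ K * a * L * (1 / (2 * (K * a * L + 1))) := by
          gcongr
          exact min_le_right _ _
      _ ≤ 1 / 2 := by
          rw [mul_one_div, div_le_div_iff₀ (by positivity) two_pos]
          linarith
  obtain ⟨D, hD, hb⟩ := StepData.exists_norm_local_error_le.{u} (M := M) hAS hASI hp hK hres hL.le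
    hsmall
  refine ⟨D + 1, by positivity, h₀, hpos, fun E _ _ _ P r hpr hP t ht h hh hlt => ⟨?_, ?_⟩⟩
  · exact hASI.existsUnique_isStageSolution hK (hres E) hP hh hlt.le hsmall _
  · intro Y hY htf
    -- The assumptions are weakened from r to p, so that the constants do not depend on r.
    let κ : StepData.{u} R p L M h₀ :=
      { E := E
        P := P
        assumption := hP.mono hpr
        t := t
        mem := ht
        h := h
        h_nonneg := hh
        h_le := hlt.le
        h_le_one := hlt.le.trans (min_le_left _ _)
        Y := Y
        stage := hY }
    refine (hb κ htf).trans ?_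
    exact mul_le_mul_of_nonneg_right (by linarith) (pow_nonneg hh _)
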